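/- Let $k$ be a commutative ring, let $A$ and $B$ be (associative unital) $k$-algebras, let $\mathfrak{D}$ be a $B$-coring with coproduct $\Delta_{\mathfrak D}(d)=\sum d_{(1)}\otimes_B d_{(2)}$ and counit $\varepsilon_{\mathfrak D}$, and let $\mathfrak{C}$ be an $A$-coring. Bimodules are $k$-symmetric, and $\mathcal M^{\mathfrak C}$, $\mathcal M^{\mathfrak D}$ are the categories of right comodules with coactions written $m\mapsto \sum m_{(0)}\otimes m_{(1)}$. For a right $\mathfrak C$-comodule $N$ and a left $\mathfrak C$-comodule $Y$, the cotensor product $N\Box_{\mathfrak C}Y$ is the kernel of $$\varrho^N\otimes_A Y-N\otimes_A{}^Y\!\varrho:\ N\otimes_AY\to N\otimes_A\mathfrak C\otimes_AY,$$ and similarly for $\mathfrak D$. Let $(\Sigma,\sigma)$ be a $((\mathfrak D:B),(\mathfrak C:A))$-module-morphism. That is, $\Sigma$ is a $(B,A)$-bimodule that is finitely generated and projective as a right $A$-module, with dual $\Sigma^*=\mathrm{Hom}_A(\Sigma,A)$ and finite dual basis $\{e_i\in\Sigma,\ e_i^*\in\Sigma^*\}$, and $\sigma:\Sigma[\mathfrak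 D]\to\mathfrak C$ is a morphism of $A$-corings, where $\Sigma[\mathfrak D]=\Sigma^*\otimes_B\mathfrak D\otimes_B\Sigma$ is the $A$-coring with coproduct $s^*\otimes d\otimes s\mapsto\sum_i s^*\otimes d_{(1)}\otimes e_i\otimes_A e_i^*\otimes d_{(2)}\otimes s$ and counit $s^*\otimes d\otimes s\mapsto s^*(\varepsilon_{\mathfrak D}(d)s)$. Assume that $\mathfrak D$ is flat as a left $B$-module. The push-out functor $\Sigma_\circ:\mathcal M^{\mathfrak D}\to\mathcal M^{\mathfrak C}$ sends $M$ to $M\otimes_B\Sigma$ with the coaction $$m\otimes s\mapsto\sum_i m_{(0)}\otimes_B e_i\otimes_A\sigma(e_i^*\otimes m_{(1)}\otimes s),$$ and a morphism $f$ to $f\otimes_B\Sigma$. The pull-back functor $\Sigma^\circ:\mathcal M^{\mathfrak C}\to\mathcal M^{\mathfrak D}$ sends $N$ to $N\Box_{\mathfrak C}(\Sigma^*\otimes_B\mathfrak D)$, where $\Sigma^*\otimes_B\mathfrak D$ has the left $\mathfrak C$-coaction $s^*\otimes d\mapsto\sum_i\sigma(s^*\otimes d_{(1)}\otimes e_i)\otimes_A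 e_i^*\otimes_B d_{(2)}$ and the right $\mathfrak D$-coaction $\Sigma^*\otimes_B\Delta_{\mathfrak D}$. The right $\mathfrak D$-coaction on $N\Box_{\mathfrak C}(\Sigma^*\otimes_B\mathfrak D)$ is the restriction of $N\otimes_A\Sigma^*\otimes_B\Delta_{\mathfrak D}$, and $\Sigma^\circ$ sends a morphism $f$ to the restriction of $f\otimes_A(\Sigma^*\otimes_B\mathfrak D)$. View $\mathfrak D\otimes_B\Sigma$ as a left $\mathfrak D$-comodule with coaction $\Delta_{\mathfrak D}\otimes_B\Sigma$. A left $\mathfrak D$-comodule $Y$ is faithfully coflat if the functor $-\Box_{\mathfrak D}Y$ from $\mathcal M^{\mathfrak D}$ to the category of $k$-modules preserves and reflects exact sequences. Then the following statements are equivalent: (a) $\sigma$ is an isomorphism of $A$-corings and $\mathfrak D\otimes_B\Sigma$ is a faithfully coflat left $\mathfrak D$-comodule; (b) $\mathfrak C$ is flat as a left $A$-module, and $\Sigma^\circ$ is an equivalence of categories with inverse $\Sigma_\circ$. -/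

import Mathlib

open CategoryTheory MulOpposite
open scoped TensorProduct

universe u

namespace BimCoring

/-! ## Bimodules over algebras and their tensor products -/

/-- An `(R, S)`-bimodule over the `k`-algebras `R` and `S`: an abelian group with commuting left
`R`-action and right `S`-action (the latter written as an action of `Sᵐᵒᵖ`), on which the two
induced actions of the ground ring `k` agree.  For `R = k` this is the same thing as a right
`S`-module, for `S = k` a left `R`-module, and for `R = S = k` a `k`-module. -/
structure BiModule (k : Type u) [CommRing k] (R S : Type u) [Ring R] [Algebra k R]
    [Ring S] [Algebra k S] where
  carrier : Type u
  [addCommGroup : AddCommGroup carrier]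
  [leftModule : Module R carrier]
  [rightModule : Module Sᵐᵒᵖ carrier]
  [smulComm : SMulCommClass R Sᵐᵒᵖ carrier]
  central : ∀ (r : k) (x : carrier), algebraMap k R r • x = op (algebraMap k S r) • x

attribute [instance] BiModule.addCommGroup BiModule.leftModule BiModule.rightModule BiModule.smulComm

variable {k : Type u} [CommRing k]
  {R : Type u} [Ring R] [Algebra k R] {S : Type u} [Ring S] [Algebra k S]
  {T : Type u} [Ring T] [Algebra k T] {U : Type u} [Ring U] [Algebra k U]
  {A : Type u} [Ring A] [Algebra k A] {B : Type u} [Ring B] [Algebra k B]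

namespace BiModule

instance : CoeSort (BiModule k R S) (Type u) := ⟨BiModule.carrier⟩

/-- Bimodule maps: additive maps that are linear on both sides. -/
@[ext]
structure Hom (X Y : BiModule k R S) where
  toFun : X → Y
  map_add' : ∀ x y : X, toFun (x + y) = toFun x + toFun y
  map_smul' : ∀ (r : R) (x : X), toFun (r • x) = r • toFun x
  map_op_smul' : ∀ (s : S) (x : X), toFun (op s • x) = op s • toFun x

instance (X Y : BiModule k R S) : FunLike (Hom X Y) X Y where
  coe := Hom.toFun
  coe_injective _ _ h := Hom.ext h

instance (X Y : BiModule k R S) : AddMonoidHomClass (Hom X Y) X Y where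
  map_add f := f.map_add'
  map_zero f := by
    have h : f 0 + f 0 = f 0 + 0 := by
      refine (f.map_add' 0 0).symm.trans ?_
      rw [add_zero, add_zero]; rfl
    exact add_left_cancel h

@[ext]
theorem hom_ext {X Y : BiModule k R S} {f g : Hom X Y} (h : ∀ x, f x = g x) : f = g :=
  DFunLike.ext f g h

@[simp] theorem Hom.map_smul {X Y : BiModule k R S} (f : Hom X Y) (r : R) (x : X) :
    f (r • x) = r • f x := f.map_smul' r x

@[simp] theorem Hom.map_op_smul {X Y : BiModule k R S} (f : Hom X Y) (s : S) (x : X) :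
    f (op s • x) = op s • f x := f.map_op_smul' s x

/-- The identity map. -/
def Hom.id (X : BiModule k R S) : Hom X X := ⟨fun x => x, fun _ _ => rfl, fun _ _ => rfl, fun _ _ => rfl⟩

@[simp] theorem Hom.id_apply {X : BiModule k R S} (x : X) : Hom.id X x = x := rfl

/-- Composition of bimodule maps, `(g.comp f) x = g (f x)`. -/
def Hom.comp {X Y Z : BiModule k R S} (g : Hom Y Z) (f : Hom X Y) : Hom X Z where
  toFun x := g (f x)
  map_add' x y := by simp
  map_smul' r x := by simp
  map_op_smul' s x := by simp

@[simp] theorem Hom.comp_apply {X Y Z : BiModule k R S} (g : Hom Y Z) (f : Hom X Y) (x : X) :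
    g.comp f x = g (f x) := rfl

/-- The zero map. -/
def Hom.zero (X Y : BiModule k R S) : Hom X Y where
  toFun _ := 0
  map_add' _ _ := by simp
  map_smul' _ _ := by simp
  map_op_smul' _ _ := by simp

@[simp] theorem Hom.zero_apply {X Y : BiModule k R S} (x : X) : Hom.zero X Y x = 0 := rfl

/-- The difference of two bimodule maps. -/
def Hom.sub {X Y : BiModule k R S} (f g : Hom X Y) : Hom X Y where
  toFun x := f x - g x
  map_add' x y := by simp only [map_add]; abel
  map_smul' r x := by simp [smul_sub]
  map_op_smul' s x := by simp [smul_sub]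

@[simp] theorem Hom.sub_apply {X Y : BiModule k R S} (f g : Hom X Y) (x : X) :
    f.sub g x = f x - g x := rfl

variable (k R) in
/-- The regular bimodule `R`. -/
def regular : BiModule k R R where
  carrier := R
  central r x := by
    change algebraMap k R r * x = x * algebraMap k R r
    exact Algebra.commutes r x

/-! ### The tensor product `X ⊗_S Y` -/

/-- The relations `x s ⊗ y = x ⊗ s y`. -/
def tensorRel (X : BiModule k R S) (Y : BiModule k S T) : AddSubgroup (X ⊗[ℤ] Y) :=
  AddSubgroup.closure {z | ∃ (x : X) (s : S) (y : Y), z = (op s • x) ⊗ₜ[ℤ] y - x ⊗ₜ[ℤ] (s • y)}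

/-- The abelian group underlying `X ⊗_S Y`. -/
def TensorCarrier (X : BiModule k R S) (Y : BiModule k S T) : Type u := (X ⊗[ℤ] Y) ⧸ tensorRel X Y

instance (X : BiModule k R S) (Y : BiModule k S T) : AddCommGroup (TensorCarrier X Y) :=
  inferInstanceAs (AddCommGroup ((X ⊗[ℤ] Y) ⧸ tensorRel X Y))

/-- The class of `x ⊗ y`. -/
def tmk {X : BiModule k R S} {Y : BiModule k S T} (x : X) (y : Y) : TensorCarrier X Y :=
  QuotientAddGroup.mk' (tensorRel X Y) (x ⊗ₜ[ℤ] y)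

theorem tmk_ind {X : BiModule k R S} {Y : BiModule k S T} {p : TensorCarrier X Y → Prop}
    (h0 : p 0) (ht : ∀ x y, p (tmk x y)) (ha : ∀ z w, p z → p w → p (z + w))
    (z : TensorCarrier X Y) : p z := by
  obtain ⟨z, rfl⟩ := QuotientAddGroup.mk'_surjective (tensorRel X Y) z
  induction z using TensorProduct.induction_on with
  | zero => rw [map_zero]; exact h0
  | tmul x y => exact ht x y
  | add a b ha' hb' => rw [map_add]; exact ha _ _ ha' hb'

theorem tmk_add {X : BiModule k R S} {Y : BiModule k S T} (x : X) (y y' : Y) :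
    tmk x (y + y') = tmk x y + tmk x y' := by
  simp only [tmk, TensorProduct.tmul_add, map_add]; rfl

theorem add_tmk {X : BiModule k R S} {Y : BiModule k S T} (x x' : X) (y : Y) :
    tmk (x + x') y = tmk x y + tmk x' y := by
  simp only [tmk, TensorProduct.add_tmul, map_add]; rfl

theorem tmk_balanced {X : BiModule k R S} {Y : BiModule k S T} (x : X) (s : S) (y : Y) :
    tmk (op s • x) y = tmk x (s • y) := by
  refine QuotientAddGroup.eq.2 ?_
  rw [← neg_mem_iff, neg_add_rev, neg_neg, add_comm, ← sub_eq_add_neg]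
  exact AddSubgroup.subset_closure ⟨x, s, y, rfl⟩

/-- The additive map out of `X ⊗_S Y` given by a biadditive balanced map. -/
def lift {X : BiModule k R S} {Y : BiModule k S T} {P : Type u} [AddCommGroup P] (f : X → Y → P)
    (h₁ : ∀ x x' y, f (x + x') y = f x y + f x' y) (h₂ : ∀ x y y', f x (y + y') = f x y + f x y')
    (h₃ : ∀ x (s : S) y, f (op s • x) y = f x (s • y)) : TensorCarrier X Y →+ P :=
  QuotientAddGroup.lift (tensorRel X Y)
    (TensorProduct.liftAddHom
      (AddMonoidHom.mk' (fun x => AddMonoidHom.mk' (f x) (h₂ x))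
        (fun x x' => by ext y; exact h₁ x x' y))
      (fun r x y => by simp [map_zsmul]))
    ((AddSubgroup.closure_le _).2 (by
      rintro _ ⟨x, s, y, rfl⟩
      simp [h₃]))

@[simp] theorem lift_tmk {X : BiModule k R S} {Y : BiModule k S T} {P : Type u} [AddCommGroup P]
    (f : X → Y → P) (h₁ h₂ h₃) (x : X) (y : Y) : lift f h₁ h₂ h₃ (tmk x y) = f x y := rfl

instance (X : BiModule k R S) (Y : BiModule k S T) : Module R (TensorCarrier X Y) where
  smul r := lift (fun x y => tmk (r • x) y) (fun x x' y => by rw [smul_add, add_tmk])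
    (fun x y y' => tmk_add _ _ _) (fun x s y => by rw [smul_comm, tmk_balanced])
  one_smul z := by
    induction z using tmk_ind with
    | h0 => exact map_zero _
    | ht x y => exact (lift_tmk _ _ _ _ _ _).trans (by rw [one_smul])
    | ha z w hz hw => exact (map_add _ _ _).trans (congrArg₂ _ hz hw)
  mul_smul r r' z := by
    induction z using tmk_ind with
    | h0 => exact (map_zero _).trans ((congrArg _ (map_zero _)).trans (map_zero _)).symm
    | ht x y => exact congrArg (fun x => tmk x y) (mul_smul r r' x)
    | ha z w hz hw =>
      exact (map_add _ _ _).trans ((congrArg₂ _ hz hw).trans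
        ((congrArg _ (map_add _ _ _)).trans (map_add _ _ _)).symm)
  smul_zero r := map_zero _
  smul_add r := map_add _
  add_smul r r' z := by
    induction z using tmk_ind with
    | h0 => exact (map_zero _).trans ((congrArg₂ _ (map_zero _) (map_zero _)).trans (add_zero _)).symm
    | ht x y => exact (congrArg (fun x => tmk x y) (add_smul r r' x)).trans (add_tmk _ _ _)
    | ha z w hz hw =>
      refine (map_add _ _ _).trans ((congrArg₂ _ hz hw).trans ?_)
      refine Eq.trans ?_ (congrArg₂ _ (map_add _ _ _) (map_add _ _ _)).symm
      exact add_add_add_comm _ _ _ _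
  zero_smul z := by
    induction z using tmk_ind with
    | h0 => exact map_zero _
    | ht x y =>
      have h : tmk (0 : X) y = 0 := by
        have := add_tmk (0 : X) 0 y
        rw [add_zero] at this
        exact left_eq_add.1 this
      exact (congrArg (fun x => tmk x y) (zero_smul R x)).trans h
    | ha z w hz hw => exact (map_add _ _ _).trans ((congrArg₂ _ hz hw).trans (add_zero _))

instance (X : BiModule k R S) (Y : BiModule k S T) : Module Tᵐᵒᵖ (TensorCarrier X Y) where
  smul t := lift (fun x y => tmk x (t • y)) (fun x x' y => add_tmk _ _ _)
    (fun x y y' => by rw [smul_add, tmk_add]) (fun x s y => by rw [tmk_balanced, smul_comm])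
  one_smul z := by
    induction z using tmk_ind with
    | h0 => exact map_zero _
    | ht x y => exact (lift_tmk _ _ _ _ _ _).trans (by rw [one_smul])
    | ha z w hz hw => exact (map_add _ _ _).trans (congrArg₂ _ hz hw)
  mul_smul r r' z := by
    induction z using tmk_ind with
    | h0 => exact (map_zero _).trans ((congrArg _ (map_zero _)).trans (map_zero _)).symm
    | ht x y => exact congrArg (fun y => tmk x y) (mul_smul r r' y)
    | ha z w hz hw =>
      exact (map_add _ _ _).trans ((congrArg₂ _ hz hw).trans
        ((congrArg _ (map_add _ _ _)).trans (map_add _ _ _)).symm)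
  smul_zero r := map_zero _
  smul_add r := map_add _
  add_smul r r' z := by
    induction z using tmk_ind with
    | h0 => exact (map_zero _).trans ((congrArg₂ _ (map_zero _) (map_zero _)).trans (add_zero _)).symm
    | ht x y => exact (congrArg (fun y => tmk x y) (add_smul r r' y)).trans (tmk_add _ _ _)
    | ha z w hz hw =>
      refine (map_add _ _ _).trans ((congrArg₂ _ hz hw).trans ?_)
      refine Eq.trans ?_ (congrArg₂ _ (map_add _ _ _) (map_add _ _ _)).symm
      exact add_add_add_comm _ _ _ _
  zero_smul z := by
    induction z using tmk_ind with
    | h0 => exact map_zero _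
    | ht x y =>
      have h : tmk x (0 : Y) = 0 := by
        have := tmk_add x (0 : Y) 0
        rw [add_zero] at this
        exact left_eq_add.1 this
      exact (congrArg (fun y => tmk x y) (zero_smul Tᵐᵒᵖ y)).trans h
    | ha z w hz hw => exact (map_add _ _ _).trans ((congrArg₂ _ hz hw).trans (add_zero _))

theorem smul_tmk {X : BiModule k R S} {Y : BiModule k S T} (r : R) (x : X) (y : Y) :
    r • tmk x y = tmk (r • x) y := rfl

theorem op_smul_tmk {X : BiModule k R S} {Y : BiModule k S T} (t : Tᵐᵒᵖ) (x : X) (y : Y) :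
    t • tmk x y = tmk x (t • y) := rfl

/-- The tensor product `X ⊗_S Y` of an `(R, S)`-bimodule and an `(S, T)`-bimodule, an
`(R, T)`-bimodule. -/
def tensor (X : BiModule k R S) (Y : BiModule k S T) : BiModule k R T where
  carrier := TensorCarrier X Y
  smulComm := ⟨fun r t z => by
    induction z using tmk_ind with
    | h0 => simp
    | ht x y => simp only [smul_tmk, op_smul_tmk]
    | ha z w hz hw => simp only [smul_add, hz, hw]⟩
  central r z := by
    induction z using tmk_ind with
    | h0 => simp
    | ht x y => rw [smul_tmk, op_smul_tmk, X.central, tmk_balanced, Y.central]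
    | ha z w hz hw => simp only [smul_add, hz, hw]

/-- The element `x ⊗ y` of `X ⊗_S Y`. -/
def tmul {X : BiModule k R S} {Y : BiModule k S T} (x : X) (y : Y) : X.tensor Y := tmk x y

end BiModule

infixl:70 " ⊗ᵇ " => BiModule.tensor
infixl:70 " ⊠ " => BiModule.tmul

namespace BiModule

theorem tensor_ind {X : BiModule k R S} {Y : BiModule k S T} {p : X ⊗ᵇ Y → Prop}
    (z : X ⊗ᵇ Y) (zero : p 0) (tmul : ∀ x y, p (x ⊠ y))
    (add : ∀ z w, p z → p w → p (z + w)) : p z := tmk_ind zero tmul add z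

theorem tmul_add {X : BiModule k R S} {Y : BiModule k S T} (x : X) (y y' : Y) :
    x ⊠ (y + y') = x ⊠ y + x ⊠ y' := tmk_add x y y'

theorem add_tmul {X : BiModule k R S} {Y : BiModule k S T} (x x' : X) (y : Y) :
    (x + x') ⊠ y = x ⊠ y + x' ⊠ y := add_tmk x x' y

theorem tmul_balanced {X : BiModule k R S} {Y : BiModule k S T} (x : X) (s : S) (y : Y) :
    (op s • x) ⊠ y = x ⊠ (s • y) := tmk_balanced x s y

theorem smul_tmul {X : BiModule k R S} {Y : BiModule k S T} (r : R) (x : X) (y : Y) :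
    r • (x ⊠ y) = (r • x) ⊠ y := rfl

theorem op_smul_tmul {X : BiModule k R S} {Y : BiModule k S T} (t : Tᵐᵒᵖ) (x : X) (y : Y) :
    t • (x ⊠ y) = x ⊠ (t • y) := rfl

@[simp] theorem tmul_zero {X : BiModule k R S} {Y : BiModule k S T} (x : X) :
    x ⊠ (0 : Y) = 0 := by
  have := tmul_add x (0 : Y) 0
  rw [add_zero] at this
  exact left_eq_add.1 this

@[simp] theorem zero_tmul {X : BiModule k R S} {Y : BiModule k S T} (y : Y) :
    (0 : X) ⊠ y = 0 := by
  have := add_tmul (0 : X) 0 y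
  rw [add_zero] at this
  exact left_eq_add.1 this

theorem tmul_sub {X : BiModule k R S} {Y : BiModule k S T} (x : X) (y y' : Y) :
    x ⊠ (y - y') = x ⊠ y - x ⊠ y' := by
  rw [eq_sub_iff_add_eq, ← tmul_add, sub_add_cancel]

theorem sub_tmul {X : BiModule k R S} {Y : BiModule k S T} (x x' : X) (y : Y) :
    (x - x') ⊠ y = x ⊠ y - x' ⊠ y := by
  rw [eq_sub_iff_add_eq, ← add_tmul, sub_add_cancel]

theorem tmul_sum {X : BiModule k R S} {Y : BiModule k S T} {ι : Type*} (s : Finset ι) (x : X)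
    (y : ι → Y) : x ⊠ (∑ i ∈ s, y i) = ∑ i ∈ s, x ⊠ y i :=
  map_sum (AddMonoidHom.mk' (fun y : Y => x ⊠ y) (tmul_add x)) y s

theorem sum_tmul {X : BiModule k R S} {Y : BiModule k S T} {ι : Type*} (s : Finset ι) (x : ι → X)
    (y : Y) : (∑ i ∈ s, x i) ⊠ y = ∑ i ∈ s, x i ⊠ y :=
  map_sum (AddMonoidHom.mk' (fun x : X => x ⊠ y) (fun x x' => add_tmul x x' y)) x s

/-- `lift`, as a map on the bimodule `X ⊗_S Y`. -/
def liftAdd {X : BiModule k R S} {Y : BiModule k S T} {P : Type u} [AddCommGroup P] (f : X → Y → P)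
    (h₁ : ∀ x x' y, f (x + x') y = f x y + f x' y) (h₂ : ∀ x y y', f x (y + y') = f x y + f x y')
    (h₃ : ∀ x (s : S) y, f (op s • x) y = f x (s • y)) : (X ⊗ᵇ Y : BiModule k R T) →+ P :=
  lift f h₁ h₂ h₃

@[simp] theorem liftAdd_tmul {X : BiModule k R S} {Y : BiModule k S T} {P : Type u} [AddCommGroup P]
    (f : X → Y → P) (h₁ h₂ h₃) (x : X) (y : Y) : liftAdd f h₁ h₂ h₃ (x ⊠ y) = f x y := rfl

/-- The bimodule map out of `X ⊗_S Y` given by a biadditive, balanced, bilinear map. -/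
def liftHom {X : BiModule k R S} {Y : BiModule k S T} {Z : BiModule k R T} (f : X → Y → Z)
    (h₁ : ∀ x x' y, f (x + x') y = f x y + f x' y) (h₂ : ∀ x y y', f x (y + y') = f x y + f x y')
    (h₃ : ∀ x (s : S) y, f (op s • x) y = f x (s • y))
    (h₄ : ∀ (r : R) x y, f (r • x) y = r • f x y)
    (h₅ : ∀ (t : T) x y, f x (op t • y) = op t • f x y) : Hom (X ⊗ᵇ Y) Z where
  toFun := liftAdd f h₁ h₂ h₃
  map_add' := map_add _
  map_smul' r z := by
    induction z using tensor_ind with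
    | zero => simp
    | tmul x y => exact h₄ r x y
    | add z w hz hw => simp only [smul_add, map_add, hz, hw]
  map_op_smul' t z := by
    induction z using tensor_ind with
    | zero => simp
    | tmul x y => exact h₅ t x y
    | add z w hz hw => simp only [smul_add, map_add, hz, hw]

@[simp] theorem liftHom_tmul {X : BiModule k R S} {Y : BiModule k S T} {Z : BiModule k R T}
    (f : X → Y → Z) (h₁ h₂ h₃ h₄ h₅) (x : X) (y : Y) :
    liftHom f h₁ h₂ h₃ h₄ h₅ (x ⊠ y) = f x y := rfl

/-- `f ⊗ g`. -/
def map {X X' : BiModule k R S} {Y Y' : BiModule k S T} (f : Hom X X') (g : Hom Y Y') :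
    Hom (X ⊗ᵇ Y) (X' ⊗ᵇ Y') :=
  liftHom (fun x y => f x ⊠ g y) (fun x x' y => by rw [map_add, add_tmul])
    (fun x y y' => by rw [map_add, tmul_add])
    (fun x s y => by rw [f.map_op_smul, g.map_smul, tmul_balanced])
    (fun r x y => by rw [f.map_smul, smul_tmul]) (fun t x y => by rw [g.map_op_smul, op_smul_tmul])

@[simp] theorem map_tmul {X X' : BiModule k R S} {Y Y' : BiModule k S T} (f : Hom X X')
    (g : Hom Y Y') (x : X) (y : Y) : map f g (x ⊠ y) = f x ⊠ g y := rfl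

/-- `f ⊗ Y`. -/
def mapLeft {X X' : BiModule k R S} (f : Hom X X') (Y : BiModule k S T) : Hom (X ⊗ᵇ Y) (X' ⊗ᵇ Y) :=
  map f (Hom.id Y)

/-- `X ⊗ g`. -/
def mapRight (X : BiModule k R S) {Y Y' : BiModule k S T} (g : Hom Y Y') : Hom (X ⊗ᵇ Y) (X ⊗ᵇ Y') :=
  map (Hom.id X) g

@[simp] theorem mapLeft_tmul {X X' : BiModule k R S} (f : Hom X X') (Y : BiModule k S T) (x : X)
    (y : Y) : mapLeft f Y (x ⊠ y) = f x ⊠ y := rfl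

@[simp] theorem mapRight_tmul (X : BiModule k R S) {Y Y' : BiModule k S T} (g : Hom Y Y') (x : X)
    (y : Y) : mapRight X g (x ⊠ y) = x ⊠ g y := rfl

/-- The map `x ⊗ y ↦ x ⊗ (y ⊗ z)` for a fixed `z`. -/
def assocAux (X : BiModule k R S) (Y : BiModule k S T) {Z : BiModule k T U} (z : Z) :
    (X ⊗ᵇ Y : BiModule k R T) →+ (X ⊗ᵇ (Y ⊗ᵇ Z) : BiModule k R U) :=
  liftAdd (fun x y => x ⊠ (y ⊠ z)) (fun x x' y => add_tmul _ _ _)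
    (fun x y y' => by rw [add_tmul, tmul_add])
    (fun x s y => by rw [tmul_balanced, smul_tmul])

@[simp] theorem assocAux_tmul (X : BiModule k R S) (Y : BiModule k S T) {Z : BiModule k T U} (z : Z)
    (x : X) (y : Y) : assocAux X Y z (x ⊠ y) = x ⊠ (y ⊠ z) := rfl

/-- The associativity isomorphism `(X ⊗ Y) ⊗ Z → X ⊗ (Y ⊗ Z)`. -/
def assoc (X : BiModule k R S) (Y : BiModule k S T) (Z : BiModule k T U) :
    Hom (X ⊗ᵇ Y ⊗ᵇ Z) (X ⊗ᵇ (Y ⊗ᵇ Z)) :=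
  liftHom (fun w z => assocAux X Y z w) (fun w w' z => map_add _ _ _)
    (fun w z z' => by
      induction w using tensor_ind with
      | zero => simp
      | tmul x y => simp only [assocAux_tmul, tmul_add]
      | add v w hv hw => simp only [map_add, hv, hw]; abel)
    (fun w t z => by
      induction w using tensor_ind with
      | zero => simp
      | tmul x y => simp only [assocAux_tmul, op_smul_tmul, tmul_balanced]
      | add v w hv hw => simp only [smul_add, map_add, hv, hw])
    (fun r w z => by
      induction w using tensor_ind with
      | zero => simp
      | tmul x y => simp only [assocAux_tmul, smul_tmul]
      | add v w hv hw => simp only [smul_add, map_add, hv, hw])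
    (fun t w z => by
      induction w using tensor_ind with
      | zero => simp
      | tmul x y => simp only [assocAux_tmul, op_smul_tmul]
      | add v w hv hw => simp only [smul_add, map_add, hv, hw])

@[simp] theorem assoc_tmul (X : BiModule k R S) (Y : BiModule k S T) (Z : BiModule k T U)
    (x : X) (y : Y) (z : Z) : assoc X Y Z (x ⊠ y ⊠ z) = x ⊠ (y ⊠ z) := rfl

/-- The map `y ⊗ z ↦ (x ⊗ y) ⊗ z` for a fixed `x`. -/
def assocInvAux {X : BiModule k R S} (Y : BiModule k S T) (Z : BiModule k T U) (x : X) :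
    (Y ⊗ᵇ Z : BiModule k S U) →+ (X ⊗ᵇ Y ⊗ᵇ Z : BiModule k R U) :=
  liftAdd (fun y z => x ⊠ y ⊠ z) (fun y y' z => by rw [tmul_add, add_tmul])
    (fun y z z' => tmul_add _ _ _)
    (fun y t z => by rw [← tmul_balanced, op_smul_tmul])

@[simp] theorem assocInvAux_tmul {X : BiModule k R S} (Y : BiModule k S T) (Z : BiModule k T U) (x : X)
    (y : Y) (z : Z) : assocInvAux Y Z x (y ⊠ z) = x ⊠ y ⊠ z := rfl

/-- The inverse `X ⊗ (Y ⊗ Z) → (X ⊗ Y) ⊗ Z` of the associativity isomorphism. -/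
def assocInv (X : BiModule k R S) (Y : BiModule k S T) (Z : BiModule k T U) :
    Hom (X ⊗ᵇ (Y ⊗ᵇ Z)) (X ⊗ᵇ Y ⊗ᵇ Z) :=
  liftHom (fun x w => assocInvAux Y Z x w)
    (fun x x' w => by
      induction w using tensor_ind with
      | zero => simp
      | tmul y z => simp only [assocInvAux_tmul, add_tmul]
      | add v w hv hw => simp only [map_add, hv, hw]; abel)
    (fun x w w' => map_add _ _ _)
    (fun x s w => by
      induction w using tensor_ind with
      | zero => simp
      | tmul y z => simp only [assocInvAux_tmul, smul_tmul, tmul_balanced]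
      | add v w hv hw => simp only [smul_add, map_add, hv, hw])
    (fun r x w => by
      induction w using tensor_ind with
      | zero => simp
      | tmul y z => simp only [assocInvAux_tmul, smul_tmul]
      | add v w hv hw => simp only [smul_add, map_add, hv, hw])
    (fun t x w => by
      induction w using tensor_ind with
      | zero => simp
      | tmul y z => simp only [assocInvAux_tmul, op_smul_tmul]
      | add v w hv hw => simp only [smul_add, map_add, hv, hw])

@[simp] theorem assocInv_tmul (X : BiModule k R S) (Y : BiModule k S T) (Z : BiModule k T U)
    (x : X) (y : Y) (z : Z) : assocInv X Y Z (x ⊠ (y ⊠ z)) = x ⊠ y ⊠ z := rfl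

/-- Two bimodule maps on `X ⊗ Y` agree as soon as they agree on the elements `x ⊗ y`. -/
theorem tensor_hom_congr {X : BiModule k R S} {Y : BiModule k S T} {Z : BiModule k R T}
    {f g : Hom (X ⊗ᵇ Y) Z} (h : ∀ x y, f (x ⊠ y) = g (x ⊠ y)) (w : X ⊗ᵇ Y) : f w = g w := by
  induction w using tensor_ind with
  | zero => simp
  | tmul x y => exact h x y
  | add v w hv hw => simp only [map_add, hv, hw]

theorem tensor_hom_congr₃ {X : BiModule k R S} {Y : BiModule k S T} {Z : BiModule k T U}
    {W : BiModule k R U} {f g : Hom (X ⊗ᵇ Y ⊗ᵇ Z) W}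
    (h : ∀ x y z, f (x ⊠ y ⊠ z) = g (x ⊠ y ⊠ z)) (w : X ⊗ᵇ Y ⊗ᵇ Z) : f w = g w := by
  refine tensor_hom_congr (fun v z => ?_) w
  induction v using tensor_ind with
  | zero => simp
  | tmul x y => exact h x y z
  | add v w hv hw => simp only [map_add, add_tmul, hv, hw]

@[simp] theorem assoc_assocInv (X : BiModule k R S) (Y : BiModule k S T) (Z : BiModule k T U)
    (w : X ⊗ᵇ (Y ⊗ᵇ Z)) : assoc X Y Z (assocInv X Y Z w) = w := by
  refine tensor_hom_congr (f := (assoc X Y Z).comp (assocInv X Y Z)) (g := Hom.id _)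
    (fun x v => ?_) w
  induction v using tensor_ind with
  | zero => simp
  | tmul y z => rfl
  | add v w hv hw => simp only [map_add, tmul_add, hv, hw]

@[simp] theorem assocInv_assoc (X : BiModule k R S) (Y : BiModule k S T) (Z : BiModule k T U)
    (w : X ⊗ᵇ Y ⊗ᵇ Z) : assocInv X Y Z (assoc X Y Z w) = w :=
  tensor_hom_congr₃ (f := (assocInv X Y Z).comp (assoc X Y Z)) (g := Hom.id _)
    (fun _ _ _ => rfl) w

/-- The unit isomorphism `R ⊗_R X → X`, `r ⊗ x ↦ r x`. -/
def lid (X : BiModule k R S) : Hom (regular k R ⊗ᵇ X) X :=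
  liftHom (fun (r : R) x => r • x) (fun (r r' : R) x => add_smul r r' x)
    (fun (r : R) x x' => smul_add r x x')
    (fun (r s : R) x => mul_smul r s x) (fun (r r' : R) x => mul_smul r r' x)
    (fun s (r : R) x => smul_comm r (op s) x)

@[simp] theorem lid_tmul (X : BiModule k R S) (r : R) (x : X) :
    lid X (tmul (X := regular k R) r x) = r • x := rfl

/-- The unit isomorphism `X ⊗_S S → X`, `x ⊗ s ↦ x s`. -/
def rid (X : BiModule k R S) : Hom (X ⊗ᵇ regular k S) X :=
  liftHom (fun x (s : S) => op s • x) (fun x x' (s : S) => smul_add (op s) x x')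
    (fun x (s s' : S) => add_smul (op s) (op s') x)
    (fun x s (s' : S) => (mul_smul (op s') (op s) x).symm)
    (fun r x (s : S) => (smul_comm r (op s) x).symm)
    (fun t x (s : S) => mul_smul (op t) (op s) x)

@[simp] theorem rid_tmul (X : BiModule k R S) (x : X) (s : S) :
    rid X (tmul (Y := regular k S) x s) = op s • x := rfl

/-- A left `R`-module `X` is flat if `- ⊗_R X` preserves injective maps of right `R`-modules
(right `R`-modules being `(k, R)`-bimodules). -/
def LeftFlat (X : BiModule k R S) : Prop :=
  ∀ (M N : BiModule k k R) (f : Hom M N), Function.Injective f → Function.Injective (mapLeft f X)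

/-! ### The dual of a bimodule -/

/-- The right dual `X^*` of an `(R, S)`-bimodule `X`: all right `S`-linear maps `X → S`. -/
def DualCarrier (X : BiModule k R S) : Type u := X →ₗ[Sᵐᵒᵖ] S

instance (X : BiModule k R S) : AddCommGroup (DualCarrier X) :=
  inferInstanceAs (AddCommGroup (X →ₗ[Sᵐᵒᵖ] S))

instance (X : BiModule k R S) : FunLike (DualCarrier X) X S :=
  inferInstanceAs (FunLike (X →ₗ[Sᵐᵒᵖ] S) X S)

theorem dualCarrier_ext {X : BiModule k R S} {f g : DualCarrier X} (h : ∀ x, f x = g x) : f = g :=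
  LinearMap.ext h

/-- `(s f)(x) = s f(x)`. -/
instance (X : BiModule k R S) : Module S (DualCarrier X) :=
  inferInstanceAs (Module S (X →ₗ[Sᵐᵒᵖ] S))

/-- `(f r)(x) = f(r x)`. -/
instance (X : BiModule k R S) : Module Rᵐᵒᵖ (DualCarrier X) where
  smul r f := LinearMap.comp f (DistribSMul.toLinearMap Sᵐᵒᵖ X (unop r))
  one_smul f := dualCarrier_ext fun x => congrArg f (one_smul R x)
  mul_smul r r' f := dualCarrier_ext fun x => congrArg f (mul_smul (unop r') (unop r) x)
  smul_zero _ := rfl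
  smul_add _ _ _ := rfl
  add_smul r r' f := dualCarrier_ext fun x =>
    (congrArg f (add_smul (unop r) (unop r') x)).trans (LinearMap.map_add f _ _)
  zero_smul f := dualCarrier_ext fun x =>
    (congrArg f (zero_smul R x)).trans (LinearMap.map_zero f)

/-- The right dual `X^*` as an `(S, R)`-bimodule. -/
def dual (X : BiModule k R S) : BiModule k S R where
  carrier := DualCarrier X
  smulComm := ⟨fun _ _ _ => rfl⟩
  central r f := dualCarrier_ext fun x => by
    change algebraMap k S r * f x = f (algebraMap k R r • x)
    rw [X.central, Algebra.commutes]
    exact (LinearMap.map_smul f (op (algebraMap k S r)) x).symm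

instance (X : BiModule k R S) : FunLike X.dual X S := inferInstanceAs (FunLike (DualCarrier X) X S)

section dual
variable {X : BiModule k R S}

theorem dual_ext {f g : X.dual} (h : ∀ x, f x = g x) : f = g := LinearMap.ext h

@[simp] theorem dual_map_add (f : X.dual) (x y : X) : f (x + y) = f x + f y :=
  LinearMap.map_add (show X →ₗ[Sᵐᵒᵖ] S from f) x y

@[simp] theorem dual_map_op_smul (f : X.dual) (s : S) (x : X) : f (op s • x) = f x * s :=
  LinearMap.map_smul (show X →ₗ[Sᵐᵒᵖ] S from f) (op s) x

@[simp] theorem dual_add_apply (f g : X.dual) (x : X) : (f + g) x = f x + g x := rfl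

@[simp] theorem dual_smul_apply (s : S) (f : X.dual) (x : X) : (s • f) x = s * f x := rfl

@[simp] theorem dual_op_smul_apply (r : R) (f : X.dual) (x : X) : (op r • f) x = f (r • x) := rfl

theorem dual_sum_apply {ι : Type*} (t : Finset ι) (f : ι → X.dual) (x : X) :
    (∑ i ∈ t, f i) x = ∑ i ∈ t, f i x :=
  map_sum (AddMonoidHom.mk' (fun f : X.dual => f x) (fun _ _ => rfl)) f t

theorem dual_map_sum {ι : Type*} (t : Finset ι) (f : X.dual) (x : ι → X) :
    f (∑ i ∈ t, x i) = ∑ i ∈ t, f (x i) :=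
  map_sum (AddMonoidHom.mk' (fun x : X => f x) (dual_map_add f)) x t

end dual

/-- The evaluation map `X^* ⊗_R X → S`, `f ⊗ x ↦ f(x)`. -/
def ev (X : BiModule k R S) : Hom (X.dual ⊗ᵇ X) (regular k S) :=
  liftHom (fun f x => f x) (fun f g x => dual_add_apply f g x) (fun f x y => dual_map_add f x y)
    (fun f r x => dual_op_smul_apply r f x) (fun s f x => dual_smul_apply s f x)
    (fun s f x => dual_map_op_smul f s x)

@[simp] theorem ev_tmul (X : BiModule k R S) (f : X.dual) (x : X) : ev X (f ⊠ x) = f x := rfl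

/-- `X` is finitely generated and projective as a right `S`-module. -/
class RightFGP (X : BiModule k R S) : Prop where
  finite : Module.Finite Sᵐᵒᵖ X
  projective : Module.Projective Sᵐᵒᵖ X

/-- A finite dual basis `e i ∈ X`, `e* i ∈ X^*` of the right `S`-module `X`. -/
structure DualBasis (X : BiModule k R S) where
  n : ℕ
  e : Fin n → X
  f : Fin n → X.dual
  sum_eq : ∀ x : X, ∑ i, op (f i x) • e i = x

theorem nonempty_dualBasis (X : BiModule k R S) [h : RightFGP X] : Nonempty (DualBasis X) := by
  obtain ⟨h₁, h₂⟩ := h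
  obtain ⟨n, p, q, -, -, hpq⟩ := Module.Finite.exists_comp_eq_id_of_projective Sᵐᵒᵖ X
  refine ⟨⟨n, fun i => p (Pi.single i 1), fun i =>
    show X →ₗ[Sᵐᵒᵖ] S from
      { toFun := fun x => unop (q x i)
        map_add' := fun x y => by simp
        map_smul' := fun s x => by simp }, fun x => ?_⟩⟩
  have h : p (q x) = x := LinearMap.congr_fun hpq x
  conv_rhs => rw [← h, pi_eq_sum_univ' (q x)]
  rw [map_sum]
  refine Finset.sum_congr rfl fun i _ => ?_
  exact (map_smul p (q x i) _).symm

/-- A chosen dual basis.  The maps built from it below only depend on the element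
`∑ i, e i ⊗ e* i` of `X ⊗ X^*`, which is the same for all dual bases (`DualBasis.coev_eq`). -/
noncomputable def dualBasis (X : BiModule k R S) [RightFGP X] : DualBasis X :=
  (nonempty_dualBasis X).some

namespace DualBasis
variable {X : BiModule k R S} (b : DualBasis X)

theorem sum_dual_eq (g : X.dual) : ∑ i, g (b.e i) • b.f i = g := by
  refine dual_ext fun x => ?_
  conv_rhs => rw [← b.sum_eq x]
  simp [dual_sum_apply, dual_map_sum]

theorem coev_eq (b' : DualBasis X) :
    ∑ i, (b.e i ⊠ b.f i : X ⊗ᵇ X.dual) = ∑ i, b'.e i ⊠ b'.f i := by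
  have h : ∀ i, b.e i ⊠ b.f i = ∑ j, b'.e j ⊠ (b'.f j (b.e i) • b.f i) := fun i => by
    conv_lhs => rw [← b'.sum_eq (b.e i), sum_tmul]
    exact Finset.sum_congr rfl fun j _ => tmul_balanced _ _ _
  rw [Finset.sum_congr rfl fun i _ => h i, Finset.sum_comm]
  refine Finset.sum_congr rfl fun j _ => ?_
  rw [← tmul_sum, b.sum_dual_eq]

theorem coev_central (r : R) :
    ∑ i, ((r • b.e i) ⊠ b.f i : X ⊗ᵇ X.dual) = ∑ i, b.e i ⊠ (op r • b.f i) := by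
  have h : ∀ i, (r • b.e i) ⊠ b.f i = ∑ j, b.e j ⊠ (b.f j (r • b.e i) • b.f i) := fun i => by
    conv_lhs => rw [← b.sum_eq (r • b.e i), sum_tmul]
    exact Finset.sum_congr rfl fun j _ => tmul_balanced _ _ _
  rw [Finset.sum_congr rfl fun i _ => h i, Finset.sum_comm]
  refine Finset.sum_congr rfl fun j _ => ?_
  rw [← tmul_sum]
  congr 1
  exact b.sum_dual_eq (op r • b.f j)

end DualBasis

/-- The map `Z → (Z ⊗_R X) ⊗_S X^*`, `z ↦ ∑ i, (z ⊗ e i) ⊗ e* i`. -/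
noncomputable def insertCoev (Z : BiModule k T R) (X : BiModule k R S) [RightFGP X] :
    Hom Z (Z ⊗ᵇ X ⊗ᵇ X.dual) where
  toFun z := ∑ i, z ⊠ X.dualBasis.e i ⊠ X.dualBasis.f i
  map_add' z w := by simp only [add_tmul, Finset.sum_add_distrib]
  map_smul' t z := by simp only [Finset.smul_sum, smul_tmul]
  map_op_smul' r z := by
    have h := congrArg (assocInv Z X X.dual) (congrArg (fun w => z ⊠ w)
      (X.dualBasis.coev_central r))
    simpa only [tmul_sum, map_sum, assocInv_tmul, tmul_balanced, Finset.smul_sum,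
      op_smul_tmul] using h

theorem insertCoev_apply (Z : BiModule k T R) (X : BiModule k R S) [RightFGP X] (z : Z) :
    insertCoev Z X z = ∑ i, z ⊠ X.dualBasis.e i ⊠ X.dualBasis.f i := rfl

end BiModule

open BiModule

theorem mapLeft_comp {X Y Z : BiModule k R S} (g : Hom Y Z) (f : Hom X Y)
    (W : BiModule k S T) (w : X ⊗ᵇ W) : mapLeft (g.comp f) W w = mapLeft g W (mapLeft f W w) :=
  tensor_hom_congr (f := mapLeft (g.comp f) W) (g := (mapLeft g W).comp (mapLeft f W))
    (fun _ _ => rfl) w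

theorem mapLeft_id {X : BiModule k R S} (W : BiModule k S T) (w : X ⊗ᵇ W) :
    mapLeft (Hom.id X) W w = w :=
  tensor_hom_congr (f := mapLeft (Hom.id X) W) (g := Hom.id _) (fun _ _ => rfl) w

theorem mapLeft_zero {X Y : BiModule k R S} (W : BiModule k S T) (w : X ⊗ᵇ W) :
    mapLeft (Hom.zero X Y) W w = 0 :=
  tensor_hom_congr (f := mapLeft (Hom.zero X Y) W) (g := Hom.zero _ _)
    (fun _ _ => by simp) w

/-! ## Corings and comodules -/

/-- An `A`-coring: an `A`-bimodule `C` with `A`-bimodule maps `Δ : C → C ⊗_A C` and `ε : C → A`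
satisfying coassociativity and the counit laws. -/
structure Coring (k : Type u) [CommRing k] (A : Type u) [Ring A] [Algebra k A] where
  bimod : BiModule k A A
  Δ : Hom bimod (bimod ⊗ᵇ bimod)
  ε : Hom bimod (regular k A)
  coassoc : ∀ c, assoc bimod bimod bimod (mapLeft Δ bimod (Δ c)) = mapRight bimod Δ (Δ c)
  counit_left : ∀ c, lid bimod (mapLeft ε bimod (Δ c)) = c
  counit_right : ∀ c, rid bimod (mapRight bimod ε (Δ c)) = c

/-- A morphism of `A`-corings. -/
structure CoringHom (C D : Coring k A) where
  hom : Hom C.bimod D.bimod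
  comul : ∀ c, D.Δ (hom c) = map hom hom (C.Δ c)
  counit : ∀ c, D.ε (hom c) = C.ε c

/-- A morphism of `A`-corings is an isomorphism if it has an inverse morphism of `A`-corings. -/
def CoringHom.IsIso {C D : Coring k A} (φ : CoringHom C D) : Prop :=
  ∃ ψ : CoringHom D C, (∀ c, ψ.hom (φ.hom c) = c) ∧ ∀ d, φ.hom (ψ.hom d) = d

/-- A right comodule over the `B`-coring `D` on an `(R, B)`-bimodule, with left `R`-linear
coaction.  For `R = k` these are just the right `D`-comodules, see `Comod`. -/
structure RightComod (R : Type u) [Ring R] [Algebra k R] (D : Coring k B) where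
  bimod : BiModule k R B
  ρ : Hom bimod (bimod ⊗ᵇ D.bimod)
  coassoc : ∀ m, assoc bimod D.bimod D.bimod (mapLeft ρ D.bimod (ρ m)) = mapRight bimod D.Δ (ρ m)
  counit : ∀ m, rid bimod (mapRight bimod D.ε (ρ m)) = m

/-- A left comodule over the `A`-coring `C` on an `(A, S)`-bimodule, with right `S`-linear
coaction. -/
structure LeftComod (C : Coring k A) (S : Type u) [Ring S] [Algebra k S] where
  bimod : BiModule k A S
  lam : Hom bimod (C.bimod ⊗ᵇ bimod)
  coassoc : ∀ n, assoc C.bimod C.bimod bimod (mapLeft C.Δ bimod (lam n))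
    = mapRight C.bimod lam (lam n)
  counit : ∀ n, lid bimod (mapLeft C.ε bimod (lam n)) = n

/-- A `(C, D)`-bicomodule: an `(A, B)`-bimodule with a left `C`-coaction and a right `D`-coaction
that commute. -/
structure Bicomod (C : Coring k A) (D : Coring k B) extends LeftComod C B where
  ρ : Hom bimod (bimod ⊗ᵇ D.bimod)
  coassoc_right : ∀ m, assoc bimod D.bimod D.bimod (mapLeft ρ D.bimod (ρ m))
    = mapRight bimod D.Δ (ρ m)
  counit_right : ∀ m, rid bimod (mapRight bimod D.ε (ρ m)) = m
  compat : ∀ m, assoc C.bimod bimod D.bimod (mapLeft lam D.bimod (ρ m))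
    = mapRight C.bimod ρ (lam m)

/-- The right comodule underlying a bicomodule. -/
@[reducible] def Bicomod.toRightComod {C : Coring k A} {D : Coring k B} (Y : Bicomod C D) : RightComod A D where
  bimod := Y.bimod
  ρ := Y.ρ
  coassoc := Y.coassoc_right
  counit := Y.counit_right

/-- Right `D`-comodules, the objects of the category `M^D`. -/
abbrev Comod (D : Coring k B) := RightComod (k := k) k D

namespace RightComod

/-- Colinear maps. -/
@[ext]
structure Hom {D : Coring k B} (M N : RightComod R D) where
  hom : BiModule.Hom M.bimod N.bimod
  colinear : ∀ m, N.ρ (hom m) = mapLeft hom D.bimod (M.ρ m)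

instance (D : Coring k B) : Category (RightComod R D) where
  Hom M N := Hom M N
  id M := ⟨BiModule.Hom.id _, fun m => by simp [mapLeft_id]⟩
  comp f g := ⟨g.hom.comp f.hom, fun m => by simp [mapLeft_comp, f.colinear, g.colinear]⟩

@[ext]
theorem hom_ext {D : Coring k B} {M N : RightComod R D} {f g : M ⟶ N}
    (h : ∀ m, f.hom m = g.hom m) : f = g :=
  Hom.ext (BiModule.hom_ext h)

@[simp] theorem id_hom_apply {D : Coring k B} (M : RightComod R D) (m : M.bimod) :
    Hom.hom (𝟙 M) m = m := rfl

@[simp] theorem comp_hom_apply {D : Coring k B} {M N P : RightComod R D} (f : M ⟶ N) (g : N ⟶ P)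
    (m : M.bimod) : Hom.hom (f ≫ g) m = g.hom (f.hom m) := rfl

instance (D : Coring k B) : Limits.HasZeroMorphisms (RightComod R D) where
  zero M N := ⟨⟨BiModule.Hom.zero _ _, fun m => by simp [mapLeft_zero]⟩⟩
  comp_zero f Z := hom_ext fun m => rfl
  zero_comp X {Y Z} f := hom_ext fun m => map_zero f.hom

@[simp] theorem zero_hom_apply {D : Coring k B} (M N : RightComod R D) (m : M.bimod) :
    Hom.hom (0 : M ⟶ N) m = 0 := rfl


theorem tensorLeft_aux₁ (P : BiModule k R A) {D : Coring k B} (Y : RightComod A D) (p : P.carrier)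
    (z : Y.bimod ⊗ᵇ D.bimod) :
    assoc _ _ _ (mapLeft ((assocInv P Y.bimod D.bimod).comp (mapRight P Y.ρ)) D.bimod
      (assocInv P Y.bimod D.bimod (p ⊠ z)))
    = assocInv P Y.bimod (D.bimod ⊗ᵇ D.bimod) (p ⊠ assoc _ _ _ (mapLeft Y.ρ D.bimod z)) := by
  induction z using tensor_ind with
  | zero => simp
  | tmul y d =>
    simp only [assocInv_tmul, mapLeft_tmul, BiModule.Hom.comp_apply, mapRight_tmul]
    generalize Y.ρ y = z
    induction z using tensor_ind with
    | zero => simp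
    | tmul y' d' => simp
    | add v w hv hw => simp only [map_add, tmul_add, add_tmul, hv, hw]
  | add v w hv hw => simp only [map_add, tmul_add, hv, hw]

theorem mapRight_assocInv (P : BiModule k R S) (Y : BiModule k S T) {Z W : BiModule k T U}
    (g : BiModule.Hom Z W) (p : P.carrier) (z : Y ⊗ᵇ Z) :
    mapRight (P ⊗ᵇ Y) g (assocInv P Y Z (p ⊠ z)) = assocInv P Y W (p ⊠ mapRight Y g z) := by
  induction z using tensor_ind with
  | zero => simp
  | tmul y d => simp
  | add v w hv hw => simp only [map_add, tmul_add, hv, hw]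

theorem rid_assocInv (P : BiModule k R S) (Y : BiModule k S T) (p : P.carrier)
    (z : Y ⊗ᵇ regular k T) : rid (P ⊗ᵇ Y) (assocInv P Y (regular k T) (p ⊠ z)) = p ⊠ rid Y z := by
  induction z using tensor_ind with
  | zero => simp
  | tmul y d => rfl
  | add v w hv hw => simp only [map_add, tmul_add, hv, hw]

/-- `P ⊗_A Y` with the coaction `P ⊗ ρ` induced by the coaction of `Y`. -/
@[reducible] def tensorLeft (P : BiModule k R A) {D : Coring k B} (Y : RightComod A D) : RightComod R D where
  bimod := P ⊗ᵇ Y.bimod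
  ρ := (assocInv P Y.bimod D.bimod).comp (mapRight P Y.ρ)
  coassoc m := by
    induction m using tensor_ind with
    | zero => simp
    | tmul p y =>
      simp only [BiModule.Hom.comp_apply, mapRight_tmul]
      rw [tensorLeft_aux₁, mapRight_assocInv, Y.coassoc]
    | add v w hv hw => simp only [map_add, hv, hw]
  counit m := by
    induction m using tensor_ind with
    | zero => simp
    | tmul p y =>
      simp only [BiModule.Hom.comp_apply, mapRight_tmul]
      rw [mapRight_assocInv, rid_assocInv, Y.counit]
    | add v w hv hw => simp only [map_add, hv, hw]

/-- A coring as a right comodule over itself. -/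
@[reducible] def self (D : Coring k B) : RightComod B D where
  bimod := D.bimod
  ρ := D.Δ
  coassoc := D.coassoc
  counit := D.counit_right

end RightComod

/-- The left `D`-comodule `D ⊗_B X`, with coaction `Δ ⊗ X`. -/
def LeftComod.free (D : Coring k B) (X : BiModule k B S) : LeftComod D S where
  bimod := D.bimod ⊗ᵇ X
  lam := (assoc D.bimod D.bimod X).comp (mapLeft D.Δ X)
  coassoc n := by
    induction n using tensor_ind with
    | zero => simp
    | tmul d x =>
      simp only [BiModule.Hom.comp_apply, mapLeft_tmul]
      have h₁ : ∀ z : D.bimod ⊗ᵇ D.bimod,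
          assoc D.bimod D.bimod (D.bimod ⊗ᵇ X) (mapLeft D.Δ (D.bimod ⊗ᵇ X)
            (assoc D.bimod D.bimod X (z ⊠ x)))
          = mapRight D.bimod (assoc D.bimod D.bimod X) (assoc _ _ _
            (assoc D.bimod D.bimod D.bimod (mapLeft D.Δ D.bimod z) ⊠ x)) := fun z => by
        induction z using tensor_ind with
        | zero => simp
        | tmul d d' =>
          simp only [assoc_tmul, mapLeft_tmul]
          generalize D.Δ d = z
          induction z using tensor_ind with
          | zero => simp
          | tmul y' d' => simp
          | add v w hv hw => simp only [map_add, add_tmul, hv, hw]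
        | add v w hv hw => simp only [map_add, add_tmul, hv, hw]
      have h₂ : ∀ z : D.bimod ⊗ᵇ D.bimod,
          mapRight D.bimod ((assoc D.bimod D.bimod X).comp (mapLeft D.Δ X))
            (assoc D.bimod D.bimod X (z ⊠ x))
          = mapRight D.bimod (assoc D.bimod D.bimod X) (assoc _ _ _
            (mapRight D.bimod D.Δ z ⊠ x)) := fun z => by
        induction z using tensor_ind with
        | zero => simp
        | tmul d d' => simp
        | add v w hv hw => simp only [map_add, add_tmul, hv, hw]
      rw [h₁, h₂, D.coassoc]
    | add v w hv hw => simp only [map_add, hv, hw]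
  counit n := by
    induction n using tensor_ind with
    | zero => simp
    | tmul d x =>
      simp only [BiModule.Hom.comp_apply, mapLeft_tmul]
      have h : ∀ z : D.bimod ⊗ᵇ D.bimod, lid (D.bimod ⊗ᵇ X) (mapLeft D.ε (D.bimod ⊗ᵇ X)
            (assoc D.bimod D.bimod X (z ⊠ x))) = lid D.bimod (mapLeft D.ε D.bimod z) ⊠ x :=
          fun z => by
        induction z using tensor_ind with
        | zero => simp
        | tmul d d' => rfl
        | add v w hv hw => simp only [map_add, add_tmul, hv, hw]
      rw [h, D.counit_left]
    | add v w hv hw => simp only [map_add, hv, hw]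

/-! ## Base ring extension of a coring by a bimodule

Fix a `B`-coring `D` and a `(B, A)`-bimodule `X`, finitely generated projective as a right
`A`-module. -/

section baseExt

variable {D : Coring k B} (X : BiModule k B A) [RightFGP X]

/-- The right `D`-comodule `X^* ⊗_B D`, with coaction `X^* ⊗ Δ`. -/
abbrev dualTensor (D : Coring k B) (X : BiModule k B A) : RightComod A D :=
  RightComod.tensorLeft X.dual (RightComod.self D)

/-- The `A`-bimodule `X[D] = X^* ⊗_B D ⊗_B X`. -/
abbrev baseExtBimod (D : Coring k B) (X : BiModule k B A) : BiModule k A A :=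
  X.dual ⊗ᵇ D.bimod ⊗ᵇ X

/-- `M ⊗ D → (M ⊗ X) ⊗ (X^* ⊗ D)`, `m ⊗ d ↦ ∑ i, (m ⊗ e i) ⊗ (e* i ⊗ d)`. -/
noncomputable def spread (M : BiModule k R B) (X : BiModule k B A) [RightFGP X]
    (D : BiModule k B T) : Hom (M ⊗ᵇ D) (M ⊗ᵇ X ⊗ᵇ (X.dual ⊗ᵇ D)) :=
  (assoc (M ⊗ᵇ X) X.dual D).comp (mapLeft (insertCoev M X) D)

theorem spread_tmul (M : BiModule k R B) (X : BiModule k B A) [RightFGP X]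
    (D : BiModule k B T) (m : M) (d : D) : spread M X D (m ⊠ d)
      = ∑ i, (m ⊠ X.dualBasis.e i) ⊠ (X.dualBasis.f i ⊠ d) := by
  simp [spread, insertCoev_apply, sum_tmul]

/-- `η_M : M → (M ⊗_B X) ⊗_A (X^* ⊗_B D)`, `m ↦ ∑ i, (m₀ ⊗ e i) ⊗ (e* i ⊗ m₁)`. -/
noncomputable def eta (M : RightComod R D) :
    Hom M.bimod (M.bimod ⊗ᵇ X ⊗ᵇ (X.dual ⊗ᵇ D.bimod)) :=
  (spread M.bimod X D.bimod).comp M.ρ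

/-- `M ⊗_B X → (M ⊗_B X) ⊗_A X[D]`, `m ⊗ x ↦ ∑ i, (m₀ ⊗ e i) ⊗ (e* i ⊗ m₁ ⊗ x)`. -/
noncomputable def pushCoaction (M : RightComod R D) :
    Hom (M.bimod ⊗ᵇ X) (M.bimod ⊗ᵇ X ⊗ᵇ baseExtBimod D X) :=
  (assoc (M.bimod ⊗ᵇ X) (X.dual ⊗ᵇ D.bimod) X).comp (mapLeft (eta X M) X)

/-- `X[D] → X[D] ⊗_A X[D]`, `f ⊗ d ⊗ x ↦ ∑ i, (f ⊗ d₁ ⊗ e i) ⊗ (e* i ⊗ d₂ ⊗ x)`. -/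
noncomputable def baseExtΔ (D : Coring k B) (X : BiModule k B A) [RightFGP X] :
    Hom (baseExtBimod D X) (baseExtBimod D X ⊗ᵇ baseExtBimod D X) :=
  pushCoaction X (dualTensor D X)

/-- `X[D] → A`, `f ⊗ d ⊗ x ↦ f(ε(d) x)`. -/
def baseExtε (D : Coring k B) (X : BiModule k B A) : Hom (baseExtBimod D X) (regular k A) :=
  (ev X).comp (mapLeft ((rid X.dual).comp (mapRight X.dual D.ε)) X)

/-- The left coaction `X^* ⊗_B D → X[D] ⊗_A (X^* ⊗_B D)`,
`f ⊗ d ↦ ∑ i, (f ⊗ d₁ ⊗ e i) ⊗ (e* i ⊗ d₂)`. -/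
noncomputable def baseExtLam (D : Coring k B) (X : BiModule k B A) [RightFGP X] :
    Hom (X.dual ⊗ᵇ D.bimod) (baseExtBimod D X ⊗ᵇ (X.dual ⊗ᵇ D.bimod)) :=
  eta X (dualTensor D X)

theorem eta_apply (M : RightComod R D) (m : M.bimod) :
    eta X M m = spread M.bimod X D.bimod (M.ρ m) := rfl

theorem pushCoaction_tmul (M : RightComod R D) (m : M.bimod) (x : X) :
    pushCoaction X M (m ⊠ x) = assoc (M.bimod ⊗ᵇ X) (X.dual ⊗ᵇ D.bimod) X (eta X M m ⊠ x) := rfl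

theorem baseExtLam_tmul (f : X.dual) (d : D.bimod) : baseExtLam D X (f ⊠ d)
    = spread (X.dual ⊗ᵇ D.bimod) X D.bimod (assocInv _ _ _ (f ⊠ D.Δ d)) := rfl

theorem baseExtΔ_tmul (y : X.dual ⊗ᵇ D.bimod) (x : X) : baseExtΔ D X (y ⊠ x)
    = assoc (baseExtBimod D X) (X.dual ⊗ᵇ D.bimod) X (baseExtLam D X y ⊠ x) := rfl

/-- `(M ⊗ D) ⊗ D → ((M ⊗ X) ⊗ X[D]) ⊗ (X^* ⊗ D)`. -/
noncomputable def spread₂ (M : BiModule k R B) (D : Coring k B) (X : BiModule k B A) [RightFGP X] :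
    Hom (M ⊗ᵇ D.bimod ⊗ᵇ D.bimod)
      (M ⊗ᵇ X ⊗ᵇ baseExtBimod D X ⊗ᵇ (X.dual ⊗ᵇ D.bimod)) :=
  ((mapLeft (assoc (M ⊗ᵇ X) (X.dual ⊗ᵇ D.bimod) X) (X.dual ⊗ᵇ D.bimod)).comp
    (spread (M ⊗ᵇ X ⊗ᵇ (X.dual ⊗ᵇ D.bimod)) X D.bimod)).comp
    (mapLeft (spread M X D.bimod) D.bimod)

theorem eta_coassoc_aux₁ (M : RightComod R D) (y : M.bimod ⊗ᵇ D.bimod) :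
    mapLeft (pushCoaction X M) (X.dual ⊗ᵇ D.bimod) (spread M.bimod X D.bimod y)
      = spread₂ M.bimod D X (mapLeft M.ρ D.bimod y) := by
  induction y using tensor_ind with
  | zero => simp
  | tmul m d =>
    simp [spread₂, spread_tmul, pushCoaction_tmul, eta_apply]
  | add v w hv hw => simp only [map_add, hv, hw]

theorem eta_coassoc_aux₂ (M : BiModule k R B) (y : M ⊗ᵇ D.bimod) :
    mapRight (M ⊗ᵇ X) (baseExtLam D X) (spread M X D.bimod y)
      = assoc _ _ _ (spread₂ M D X (assocInv _ _ _ (mapRight M D.Δ y))) := by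
  induction y using tensor_ind with
  | zero => simp
  | tmul m d =>
    simp only [spread_tmul, map_sum, mapRight_tmul, baseExtLam_tmul]
    generalize D.Δ d = z
    induction z using tensor_ind with
    | zero => simp
    | tmul d d' =>
      simp only [spread₂, assocInv_tmul, Hom.comp_apply, mapLeft_tmul, spread_tmul, sum_tmul,
        tmul_sum, map_sum, assoc_tmul]
    | add v w hv hw => simp only [map_add, tmul_add, Finset.sum_add_distrib, hv, hw]
  | add v w hv hw => simp only [map_add, hv, hw]

theorem eta_coassoc (M : RightComod R D) (m : M.bimod) :
    assoc _ _ _ (mapLeft (pushCoaction X M) (X.dual ⊗ᵇ D.bimod) (eta X M m))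
      = mapRight (M.bimod ⊗ᵇ X) (baseExtLam D X) (eta X M m) := by
  rw [eta_apply, eta_coassoc_aux₁, eta_coassoc_aux₂, ← M.coassoc, assocInv_assoc]

theorem pushCoaction_coassoc (M : RightComod R D) (w : M.bimod ⊗ᵇ X) :
    assoc _ _ _ (mapLeft (pushCoaction X M) (baseExtBimod D X) (pushCoaction X M w))
      = mapRight (M.bimod ⊗ᵇ X) (baseExtΔ D X) (pushCoaction X M w) := by
  induction w using tensor_ind with
  | zero => simp
  | tmul m x =>
    have h₁ : ∀ z : M.bimod ⊗ᵇ X ⊗ᵇ (X.dual ⊗ᵇ D.bimod),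
        assoc _ _ _ (mapLeft (pushCoaction X M) (baseExtBimod D X)
          (assoc (M.bimod ⊗ᵇ X) (X.dual ⊗ᵇ D.bimod) X (z ⊠ x)))
        = mapRight _ (assoc _ _ _) (assoc _ _ _ (assoc _ _ _
            (mapLeft (pushCoaction X M) (X.dual ⊗ᵇ D.bimod) z) ⊠ x)) := fun z => by
      induction z using tensor_ind with
      | zero => simp
      | tmul v y =>
        simp only [assoc_tmul, mapLeft_tmul]
        generalize pushCoaction X M v = z
        induction z using tensor_ind with
        | zero => simp
        | tmul y' d' => rfl
        | add v w hv hw => simp only [map_add, add_tmul, hv, hw]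
      | add v w hv hw => simp only [map_add, add_tmul, hv, hw]
    have h₂ : ∀ z : M.bimod ⊗ᵇ X ⊗ᵇ (X.dual ⊗ᵇ D.bimod),
        mapRight (M.bimod ⊗ᵇ X) (baseExtΔ D X)
          (assoc (M.bimod ⊗ᵇ X) (X.dual ⊗ᵇ D.bimod) X (z ⊠ x))
        = mapRight _ (assoc _ _ _) (assoc _ _ _
            (mapRight (M.bimod ⊗ᵇ X) (baseExtLam D X) z ⊠ x)) := fun z => by
      induction z using tensor_ind with
      | zero => simp
      | tmul v y => rfl
      | add v w hv hw => simp only [map_add, add_tmul, hv, hw]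
    rw [pushCoaction_tmul, h₁, h₂, eta_coassoc]
  | add v w hv hw => simp only [map_add, hv, hw]

theorem pushCoaction_counit (M : RightComod R D) (w : M.bimod ⊗ᵇ X) :
    rid _ (mapRight (M.bimod ⊗ᵇ X) (baseExtε D X) (pushCoaction X M w)) = w := by
  induction w using tensor_ind with
  | zero => simp
  | tmul m x =>
    rw [pushCoaction_tmul, eta_apply]
    conv_rhs => rw [← M.counit m]
    generalize M.ρ m = z
    induction z using tensor_ind with
    | zero => simp
    | tmul m' d =>
      simp only [spread_tmul, sum_tmul, map_sum, assoc_tmul, mapRight_tmul]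
      refine Eq.trans ?_ (tmul_balanced m' (show B from D.ε d) x).symm
      conv_rhs => rw [← X.dualBasis.sum_eq ((show B from D.ε d) • x), tmul_sum]
      rfl
    | add v w hv hw => simp only [map_add, add_tmul, hv, hw]
  | add v w hv hw => simp only [map_add, hv, hw]

theorem baseExtLam_counit (y : X.dual ⊗ᵇ D.bimod) :
    lid _ (mapLeft (baseExtε D X) (X.dual ⊗ᵇ D.bimod) (baseExtLam D X y)) = y := by
  induction y using tensor_ind with
  | zero => simp
  | tmul f d =>
    rw [baseExtLam_tmul]
    conv_rhs => rw [← D.counit_left d]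
    generalize D.Δ d = z
    induction z using tensor_ind with
    | zero => simp
    | tmul d d' =>
      simp only [assocInv_tmul, spread_tmul, map_sum, mapLeft_tmul]
      refine Eq.trans ?_ (tmul_balanced f (show B from D.ε d) d')
      conv_rhs => rw [← X.dualBasis.sum_dual_eq (op (show B from D.ε d) • f), sum_tmul]
      rfl
    | add v w hv hw => simp only [map_add, tmul_add, hv, hw]
  | add v w hv hw => simp only [map_add, hv, hw]

theorem eta_colinear_aux (M : BiModule k R B) (y : M ⊗ᵇ D.bimod) :
    mapRight (M ⊗ᵇ X) (dualTensor D X).ρ (spread M X D.bimod y)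
      = assoc _ _ _ (mapLeft (spread M X D.bimod) D.bimod
          (assocInv _ _ _ (mapRight M D.Δ y))) := by
  induction y using tensor_ind with
  | zero => simp
  | tmul m d =>
    simp only [spread_tmul, map_sum, mapRight_tmul, Hom.comp_apply]
    generalize D.Δ d = z
    induction z using tensor_ind with
    | zero => simp
    | tmul d d' =>
      simp only [assocInv_tmul, mapLeft_tmul, spread_tmul, sum_tmul, map_sum, assoc_tmul]
    | add v w hv hw => simp only [map_add, tmul_add, Finset.sum_add_distrib, hv, hw]
  | add v w hv hw => simp only [map_add, hv, hw]

theorem eta_colinear (M : RightComod R D) (m : M.bimod) :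
    assoc _ _ _ (mapLeft (eta X M) D.bimod (M.ρ m))
      = mapRight (M.bimod ⊗ᵇ X) (dualTensor D X).ρ (eta X M m) := by
  rw [eta_apply, eta_colinear_aux, ← M.coassoc, assocInv_assoc, eta, mapLeft_comp]

/-- The base ring extension `X[D]` of the coring `D` by the bimodule `X`. -/
@[reducible] noncomputable def baseExt (D : Coring k B) (X : BiModule k B A) [RightFGP X] : Coring k A where
  bimod := baseExtBimod D X
  Δ := baseExtΔ D X
  ε := baseExtε D X
  coassoc := pushCoaction_coassoc X (dualTensor D X)
  counit_left c := by
    induction c using tensor_ind with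
    | zero => simp
    | tmul y x =>
      have h : ∀ z : baseExtBimod D X ⊗ᵇ (X.dual ⊗ᵇ D.bimod),
          lid _ (mapLeft (baseExtε D X) (baseExtBimod D X)
            (assoc (baseExtBimod D X) (X.dual ⊗ᵇ D.bimod) X (z ⊠ x)))
          = lid _ (mapLeft (baseExtε D X) (X.dual ⊗ᵇ D.bimod) z) ⊠ x := fun z => by
        induction z using tensor_ind with
        | zero => simp
        | tmul v y => rfl
        | add v w hv hw => simp only [map_add, add_tmul, hv, hw]
      exact (h (baseExtLam D X y)).trans (by rw [baseExtLam_counit])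
    | add v w hv hw => simp only [map_add, hv, hw]
  counit_right := pushCoaction_counit X (dualTensor D X)

/-- The right `X[D]`-comodule `M ⊗_B X`. -/
noncomputable def RightComod.tensorBase (M : RightComod R D) (X : BiModule k B A) [RightFGP X] :
    RightComod R (baseExt D X) where
  bimod := M.bimod ⊗ᵇ X
  ρ := pushCoaction X M
  coassoc := pushCoaction_coassoc X M
  counit := pushCoaction_counit X M

/-- The `(X[D], D)`-bicomodule `X^* ⊗_B D`. -/
noncomputable def dualBicomod (D : Coring k B) (X : BiModule k B A) [RightFGP X] :
    Bicomod (baseExt D X) D where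
  bimod := X.dual ⊗ᵇ D.bimod
  lam := baseExtLam D X
  coassoc := eta_coassoc X (dualTensor D X)
  counit := baseExtLam_counit X
  ρ := (dualTensor D X).ρ
  coassoc_right := (dualTensor D X).coassoc
  counit_right := (dualTensor D X).counit
  compat := eta_colinear X (dualTensor D X)

end baseExt


/-! ## Corestriction along a morphism of corings -/

/-- The right `C'`-comodule obtained from a right `C`-comodule via a coring morphism `C → C'`. -/
@[reducible] def RightComod.corestrict {C C' : Coring k A} (φ : CoringHom C C')
    (M : RightComod R C) : RightComod R C' where
  bimod := M.bimod
  ρ := (mapRight M.bimod φ.hom).comp M.ρ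
  coassoc m := by
    have h₁ : ∀ z : M.bimod ⊗ᵇ C.bimod,
        assoc _ _ _ (mapLeft ((mapRight M.bimod φ.hom).comp M.ρ) C'.bimod
          (mapRight M.bimod φ.hom z))
        = mapRight M.bimod (map φ.hom φ.hom) (assoc _ _ _ (mapLeft M.ρ C.bimod z)) := fun z => by
      induction z using tensor_ind with
      | zero => simp
      | tmul m c =>
        simp only [mapRight_tmul, mapLeft_tmul, Hom.comp_apply]
        generalize M.ρ m = v
        induction v using tensor_ind with
        | zero => simp
        | tmul m c => rfl
        | add v w hv hw => simp only [map_add, add_tmul, hv, hw]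
      | add v w hv hw => simp only [map_add, hv, hw]
    have h₂ : ∀ z : M.bimod ⊗ᵇ C.bimod,
        mapRight M.bimod C'.Δ (mapRight M.bimod φ.hom z)
        = mapRight M.bimod (map φ.hom φ.hom) (mapRight M.bimod C.Δ z) := fun z => by
      induction z using tensor_ind with
      | zero => simp
      | tmul m c => simp only [mapRight_tmul, φ.comul]
      | add v w hv hw => simp only [map_add, hv, hw]
    simp only [Hom.comp_apply]
    rw [h₁, h₂, M.coassoc]
  counit m := by
    have h : ∀ z : M.bimod ⊗ᵇ C.bimod,
        mapRight M.bimod C'.ε (mapRight M.bimod φ.hom z) = mapRight M.bimod C.ε z := fun z => by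
      induction z using tensor_ind with
      | zero => simp
      | tmul m c => simp only [mapRight_tmul, φ.counit]
      | add v w hv hw => simp only [map_add, hv, hw]
    simp only [Hom.comp_apply]
    rw [h, M.counit]

/-- The `(C', D)`-bicomodule obtained from a `(C, D)`-bicomodule via a coring morphism
`C → C'`. -/
@[reducible] def Bicomod.corestrict {C C' : Coring k A} {D : Coring k B} (φ : CoringHom C C')
    (Y : Bicomod C D) : Bicomod C' D where
  bimod := Y.bimod
  lam := (mapLeft φ.hom Y.bimod).comp Y.lam
  coassoc n := by
    have h₁ : ∀ z : C.bimod ⊗ᵇ Y.bimod,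
        assoc _ _ _ (mapLeft C'.Δ Y.bimod (mapLeft φ.hom Y.bimod z))
        = map φ.hom (mapLeft φ.hom Y.bimod) (assoc _ _ _ (mapLeft C.Δ Y.bimod z)) := fun z => by
      induction z using tensor_ind with
      | zero => simp
      | tmul c y =>
        simp only [mapLeft_tmul, φ.comul]
        generalize C.Δ c = v
        induction v using tensor_ind with
        | zero => simp
        | tmul m c => rfl
        | add v w hv hw => simp only [map_add, add_tmul, hv, hw]
      | add v w hv hw => simp only [map_add, hv, hw]
    have h₂ : ∀ z : C.bimod ⊗ᵇ Y.bimod,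
        mapRight C'.bimod ((mapLeft φ.hom Y.bimod).comp Y.lam) (mapLeft φ.hom Y.bimod z)
        = map φ.hom (mapLeft φ.hom Y.bimod) (mapRight C.bimod Y.lam z) := fun z => by
      induction z using tensor_ind with
      | zero => simp
      | tmul c y => rfl
      | add v w hv hw => simp only [map_add, hv, hw]
    simp only [Hom.comp_apply]
    rw [h₁, h₂, Y.coassoc]
  counit n := by
    have h : ∀ z : C.bimod ⊗ᵇ Y.bimod,
        mapLeft C'.ε Y.bimod (mapLeft φ.hom Y.bimod z) = mapLeft C.ε Y.bimod z := fun z => by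
      induction z using tensor_ind with
      | zero => simp
      | tmul m c => simp only [mapLeft_tmul, φ.counit]
      | add v w hv hw => simp only [map_add, hv, hw]
    simp only [Hom.comp_apply]
    rw [h, Y.counit]
  ρ := Y.ρ
  coassoc_right := Y.coassoc_right
  counit_right := Y.counit_right
  compat m := by
    have h₁ : ∀ z : Y.bimod ⊗ᵇ D.bimod,
        assoc _ _ _ (mapLeft ((mapLeft φ.hom Y.bimod).comp Y.lam) D.bimod z)
        = mapLeft φ.hom (Y.bimod ⊗ᵇ D.bimod) (assoc _ _ _ (mapLeft Y.lam D.bimod z)) :=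
        fun z => by
      induction z using tensor_ind with
      | zero => simp
      | tmul y d =>
        simp only [mapLeft_tmul, Hom.comp_apply]
        generalize Y.lam y = v
        induction v using tensor_ind with
        | zero => simp
        | tmul m c => rfl
        | add v w hv hw => simp only [map_add, add_tmul, hv, hw]
      | add v w hv hw => simp only [map_add, hv, hw]
    have h₂ : ∀ z : C.bimod ⊗ᵇ Y.bimod,
        mapRight C'.bimod Y.ρ (mapLeft φ.hom Y.bimod z)
        = mapLeft φ.hom (Y.bimod ⊗ᵇ D.bimod) (mapRight C.bimod Y.ρ z) := fun z => by
      induction z using tensor_ind with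
      | zero => simp
      | tmul c y => rfl
      | add v w hv hw => simp only [map_add, hv, hw]
    simp only [Hom.comp_apply]
    rw [h₁, h₂, Y.compat]

/-! ## Kernels, cotensor products and faithful coflatness -/

namespace BiModule

/-- The subgroup underlying the kernel of a bimodule map. -/
def kerSubmodule {P W : BiModule k R S} (f : Hom P W) : Submodule R P where
  carrier := {x | f x = 0}
  add_mem' {x y} (hx : f x = 0) (hy : f y = 0) := by
    change f (x + y) = 0
    rw [map_add, hx, hy, add_zero]
  zero_mem' := map_zero f
  smul_mem' r x (hx : f x = 0) := by
    change f (r • x) = 0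
    rw [f.map_smul, hx, smul_zero]

theorem op_smul_mem_ker {P W : BiModule k R S} (f : Hom P W) (s : Sᵐᵒᵖ) (x : kerSubmodule f) :
    s • (x : P.carrier) ∈ kerSubmodule f := by
  change f (op (unop s) • (x : P.carrier)) = 0
  rw [f.map_op_smul, show f x = 0 from x.2, smul_zero]

instance {P W : BiModule k R S} (f : Hom P W) : Module Sᵐᵒᵖ (kerSubmodule f) where
  smul s x := ⟨s • (x : P.carrier), op_smul_mem_ker f s x⟩
  one_smul _ := Subtype.ext (one_smul _ _)
  mul_smul s t x := Subtype.ext (mul_smul s t (x : P.carrier))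
  smul_zero s := Subtype.ext (smul_zero s)
  smul_add s x y := Subtype.ext (smul_add s (x : P.carrier) y)
  add_smul s t x := Subtype.ext (add_smul s t (x : P.carrier))
  zero_smul _ := Subtype.ext (zero_smul _ _)

/-- The kernel of a bimodule map. -/
def ker {P W : BiModule k R S} (f : Hom P W) : BiModule k R S where
  carrier := kerSubmodule f
  smulComm := ⟨fun r s x => Subtype.ext (smul_comm r s (x : P.carrier))⟩
  central r x := Subtype.ext (P.central r (x : P.carrier))

/-- The inclusion of the kernel. -/
def kerι {P W : BiModule k R S} (f : Hom P W) : Hom (ker f) P where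
  toFun := Subtype.val
  map_add' _ _ := rfl
  map_smul' _ _ := rfl
  map_op_smul' _ _ := rfl

theorem kerι_injective {P W : BiModule k R S} (f : Hom P W) : Function.Injective (kerι f) :=
  Subtype.val_injective

@[simp] theorem apply_kerι {P W : BiModule k R S} (f : Hom P W) (x : ker f) : f (kerι f x) = 0 :=
  Subtype.property (p := fun x => f x = 0) x

/-- Elements of the kernel. -/
def kerMk {P W : BiModule k R S} (f : Hom P W) (x : P) (h : f x = 0) : ker f :=
  Subtype.mk (p := fun x => x ∈ kerSubmodule f) x h

@[simp] theorem kerι_kerMk {P W : BiModule k R S} (f : Hom P W) (x : P) (h : f x = 0) :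
    kerι f (kerMk f x h) = x := rfl

/-- The map induced on kernels. -/
def kerMap {P W P' W' : BiModule k R S} (f : Hom P W) (f' : Hom P' W') (g : Hom P P')
    (h : ∀ x, f x = 0 → f' (g x) = 0) : Hom (ker f) (ker f') where
  toFun x := kerMk f' (g (kerι f x)) (h _ (apply_kerι f x))
  map_add' x y := kerι_injective f' (by simp)
  map_smul' r x := kerι_injective f' (by simp)
  map_op_smul' s x := kerι_injective f' (by simp)

@[simp] theorem kerι_kerMap {P W P' W' : BiModule k R S} (f : Hom P W) (f' : Hom P' W')
    (g : Hom P P') (h : ∀ x, f x = 0 → f' (g x) = 0) (x : ker f) :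
    kerι f' (kerMap f f' g h x) = g (kerι f x) := rfl

/-- The subgroup underlying the range of a bimodule map. -/
def rangeSubmodule {P W : BiModule k R S} (f : Hom P W) : Submodule R W where
  carrier := {y | ∃ x, f x = y}
  add_mem' := by
    rintro _ _ ⟨x, rfl⟩ ⟨y, rfl⟩
    exact ⟨x + y, map_add f x y⟩
  zero_mem' := ⟨0, map_zero f⟩
  smul_mem' := by
    rintro r _ ⟨x, rfl⟩
    exact ⟨r • x, f.map_smul r x⟩

theorem op_smul_mem_range {P W : BiModule k R S} (f : Hom P W) (s : Sᵐᵒᵖ)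
    (x : rangeSubmodule f) : s • (x : W.carrier) ∈ rangeSubmodule f := by
  obtain ⟨_, x, rfl⟩ := x
  exact ⟨op (unop s) • x, f.map_op_smul (unop s) x⟩

instance {P W : BiModule k R S} (f : Hom P W) : Module Sᵐᵒᵖ (rangeSubmodule f) where
  smul s x := ⟨s • (x : W.carrier), op_smul_mem_range f s x⟩
  one_smul _ := Subtype.ext (one_smul _ _)
  mul_smul s t x := Subtype.ext (mul_smul s t (x : W.carrier))
  smul_zero s := Subtype.ext (smul_zero s)
  smul_add s x y := Subtype.ext (smul_add s (x : W.carrier) y)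
  add_smul s t x := Subtype.ext (add_smul s t (x : W.carrier))
  zero_smul _ := Subtype.ext (zero_smul _ _)

/-- The range of a bimodule map. -/
def range {P W : BiModule k R S} (f : Hom P W) : BiModule k R S where
  carrier := rangeSubmodule f
  smulComm := ⟨fun r s x => Subtype.ext (smul_comm r s (x : W.carrier))⟩
  central r x := Subtype.ext (W.central r (x : W.carrier))

/-- The inclusion of the range. -/
def rangeι {P W : BiModule k R S} (f : Hom P W) : Hom (range f) W where
  toFun := Subtype.val
  map_add' _ _ := rfl
  map_smul' _ _ := rfl
  map_op_smul' _ _ := rfl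

theorem rangeι_injective {P W : BiModule k R S} (f : Hom P W) : Function.Injective (rangeι f) :=
  Subtype.val_injective

/-- The corestriction of a bimodule map to its range. -/
def toRange {P W : BiModule k R S} (f : Hom P W) : Hom P (range f) where
  toFun x := Subtype.mk (p := fun x => x ∈ rangeSubmodule f) (f x) ⟨x, rfl⟩
  map_add' x y := rangeι_injective f (map_add f x y)
  map_smul' r x := rangeι_injective f (f.map_smul r x)
  map_op_smul' s x := rangeι_injective f (f.map_op_smul s x)

theorem toRange_surjective {P W : BiModule k R S} (f : Hom P W) :
    Function.Surjective (toRange f) := by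
  rintro ⟨_, x, rfl⟩
  exact ⟨x, rfl⟩

/-- Tensoring with a flat module preserves kernels. -/
theorem LeftFlat.exists_of_mapLeft_eq_zero {Y : BiModule k S T} (hY : LeftFlat Y)
    {P W : BiModule k k S} (f : Hom P W) (z : P ⊗ᵇ Y) (hz : mapLeft f Y z = 0) :
    ∃ w, mapLeft (kerι f) Y w = z := by
  let I : AddSubgroup (P ⊗ᵇ Y : BiModule k k T) :=
    (AddMonoidHom.mk' (mapLeft (kerι f) Y) (map_add _)).range
  have key : ∀ (p p' : P) (y : Y), toRange f p = toRange f p' →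
      (QuotientAddGroup.mk' I (p ⊠ y)) = QuotientAddGroup.mk' I (p' ⊠ y) := fun p p' y h => by
    rw [← sub_eq_zero, ← map_sub, ← sub_tmul]
    refine (QuotientAddGroup.eq_zero_iff _).2 ⟨kerMk f (p - p') ?_ ⊠ y, rfl⟩
    rw [map_sub, sub_eq_zero]
    exact congrArg (rangeι f) h
  let c : range f → P := Function.surjInv (toRange_surjective f)
  have hc : ∀ x, toRange f (c x) = x := Function.surjInv_eq (toRange_surjective f)
  let g : (range f ⊗ᵇ Y : BiModule k k T) →+ (P ⊗ᵇ Y : BiModule k k T) ⧸ I :=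
    liftAdd (fun x y => QuotientAddGroup.mk' I (c x ⊠ y))
      (fun x x' y => by
        rw [← map_add, ← add_tmul]
        exact key _ _ _ (by rw [map_add, hc, hc, hc]))
      (fun x y y' => by rw [tmul_add, map_add])
      (fun x s y => by
        rw [← tmul_balanced]
        exact key _ _ _ (by rw [Hom.map_op_smul, hc, hc]))
  have hg : ∀ z, g (mapLeft (toRange f) Y z) = QuotientAddGroup.mk' I z := fun z => by
    induction z using tensor_ind with
    | zero => simp
    | tmul p y => exact key _ _ _ (hc _)
    | add v w hv hw => simp only [map_add, hv, hw]
  have h0 : mapLeft (toRange f) Y z = 0 := by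
    refine hY _ _ (rangeι f) (rangeι_injective f) ?_
    rw [map_zero, ← mapLeft_comp]
    exact hz
  have := hg z
  rw [h0, map_zero] at this
  exact (QuotientAddGroup.eq_zero_iff z).1 this.symm

theorem mapLeft_sub {X Y : BiModule k R S} (f g : Hom X Y) (W : BiModule k S T) (w : X ⊗ᵇ W) :
    mapLeft (f.sub g) W w = mapLeft f W w - mapLeft g W w :=
  tensor_hom_congr (f := mapLeft (f.sub g) W) (g := (mapLeft f W).sub (mapLeft g W))
    (fun _ _ => sub_tmul _ _ _) w

end BiModule

section cotensor

variable {C : Coring k A} {D : Coring k B}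

/-- The map `ω = ρ ⊗ Y - N ⊗ λ : N ⊗_A Y → N ⊗_A C ⊗_A Y`. -/
def omega (N : RightComod R C) (Y : LeftComod C S) :
    Hom (N.bimod ⊗ᵇ Y.bimod) (N.bimod ⊗ᵇ (C.bimod ⊗ᵇ Y.bimod)) :=
  ((assoc N.bimod C.bimod Y.bimod).comp (mapLeft N.ρ Y.bimod)).sub (mapRight N.bimod Y.lam)

/-- The cotensor product `N □_C Y`, the kernel of `ω`. -/
def cotensor (N : RightComod R C) (Y : LeftComod C S) : BiModule k R S := ker (omega N Y)

theorem omega_naturality {N N' : RightComod R C} (f : N ⟶ N') (Y : LeftComod C S)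
    (z : N.bimod ⊗ᵇ Y.bimod) : omega N' Y (mapLeft f.hom Y.bimod z)
      = mapLeft f.hom (C.bimod ⊗ᵇ Y.bimod) (omega N Y z) := by
  induction z using tensor_ind with
  | zero => simp
  | tmul n y =>
    simp only [omega, Hom.sub_apply, Hom.comp_apply, mapLeft_tmul, mapRight_tmul, map_sub,
      f.colinear]
    congr 1
    generalize N.ρ n = v
    induction v using tensor_ind with
    | zero => simp
    | tmul m c => rfl
    | add v w hv hw => simp only [map_add, add_tmul, hv, hw]
  | add v w hv hw => simp only [map_add, hv, hw]

/-- The map `f □ Y`. -/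
def cotensorMap {N N' : RightComod R C} (f : N ⟶ N') (Y : LeftComod C S) :
    Hom (cotensor N Y) (cotensor N' Y) :=
  kerMap (omega N Y) (omega N' Y) (mapLeft f.hom Y.bimod)
    (fun x hx => by rw [omega_naturality, hx, map_zero])

/-- The cotensor functor `- □_C Y : M^C → M_k`. -/
def cotensorFunctor (Y : LeftComod C S) : Comod C ⥤ ModuleCat.{u} k where
  obj N := ModuleCat.of k (cotensor N Y)
  map {N N'} f := ModuleCat.ofHom
    { toFun := cotensorMap f Y
      map_add' := map_add _
      map_smul' := Hom.map_smul _ }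
  map_id N := by
    ext x
    exact kerι_injective (omega N Y) (mapLeft_id _ _)
  map_comp {N N' N''} f g := by
    ext x
    exact kerι_injective (omega N'' Y) (mapLeft_comp _ _ _ _)

instance (Y : LeftComod C S) : (cotensorFunctor Y).PreservesZeroMorphisms where
  map_zero N N' := by
    ext x
    exact kerι_injective (omega N' Y) (mapLeft_zero _ _)

/-- A left comodule `Y` over a coring `C` which is flat as a left `A`-module is faithfully coflat
if the cotensor functor `- □_C Y : M^C → M_k` preserves and reflects exact sequences.  (A functor
that preserves exactness of all complexes `N₁ → N₂ → N₃` and reflects it is faithful, so that it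
makes no difference whether sequences are required to be complexes beforehand.) -/
def FaithfullyCoflat (Y : LeftComod C S) : Prop :=
  ∀ E : ShortComplex (Comod C), E.Exact ↔ (E.map (cotensorFunctor Y)).Exact

section kerComod

variable {M W : Comod D}

theorem exists_kerCoaction (hD : LeftFlat D.bimod) (f : RightComod.Hom M W) (x : ker f.hom) :
    ∃ w, mapLeft (kerι f.hom) D.bimod w = M.ρ (kerι f.hom x) :=
  hD.exists_of_mapLeft_eq_zero f.hom _ (by rw [← f.colinear, apply_kerι, map_zero])

/-- The restriction of the coaction of `M` to the kernel of `f`. -/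
noncomputable def kerCoactionFun (hD : LeftFlat D.bimod) (f : RightComod.Hom M W) (x : ker f.hom) : ker f.hom ⊗ᵇ D.bimod :=
  (exists_kerCoaction hD f x).choose

theorem kerCoactionFun_spec (hD : LeftFlat D.bimod) (f : RightComod.Hom M W) (x : ker f.hom) :
    mapLeft (kerι f.hom) D.bimod (kerCoactionFun hD f x) = M.ρ (kerι f.hom x) :=
  (exists_kerCoaction hD f x).choose_spec

theorem mapLeft_kerι_injective (hD : LeftFlat D.bimod) (f : RightComod.Hom M W) :
    Function.Injective (mapLeft (kerι f.hom) D.bimod) :=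
  hD _ _ _ (kerι_injective f.hom)

/-- The restriction of the coaction of `M` to the kernel of `f`, as a bimodule map. -/
noncomputable def kerCoaction (hD : LeftFlat D.bimod) (f : RightComod.Hom M W) :
    Hom (ker f.hom) (ker f.hom ⊗ᵇ D.bimod) where
  toFun := kerCoactionFun hD f
  map_add' x y := mapLeft_kerι_injective hD f (by
    rw [map_add, kerCoactionFun_spec, kerCoactionFun_spec, kerCoactionFun_spec, map_add, map_add])
  map_smul' r x := mapLeft_kerι_injective hD f (by
    rw [Hom.map_smul, kerCoactionFun_spec, kerCoactionFun_spec, Hom.map_smul, Hom.map_smul])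
  map_op_smul' s x := mapLeft_kerι_injective hD f (by
    rw [Hom.map_op_smul, kerCoactionFun_spec, kerCoactionFun_spec, Hom.map_op_smul,
      Hom.map_op_smul])

theorem kerCoaction_spec (hD : LeftFlat D.bimod) (f : RightComod.Hom M W) (x : ker f.hom) :
    mapLeft (kerι f.hom) D.bimod (kerCoaction hD f x) = M.ρ (kerι f.hom x) :=
  kerCoactionFun_spec hD f x

theorem mapLeft_assoc {X Y : BiModule k R S} (g : Hom X Y) (V : BiModule k S T)
    (W : BiModule k T U) (w : X ⊗ᵇ V ⊗ᵇ W) :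
    mapLeft g (V ⊗ᵇ W) (assoc X V W w) = assoc Y V W (mapLeft (mapLeft g V) W w) :=
  tensor_hom_congr₃ (f := (mapLeft g (V ⊗ᵇ W)).comp (assoc X V W))
    (g := (assoc Y V W).comp (mapLeft (mapLeft g V) W)) (fun _ _ _ => rfl) w

theorem mapLeft_mapRight {X Y : BiModule k R S} (g : Hom X Y) {V W : BiModule k S T}
    (h : Hom V W) (w : X ⊗ᵇ V) :
    mapLeft g W (mapRight X h w) = mapRight Y h (mapLeft g V w) :=
  tensor_hom_congr (f := (mapLeft g W).comp (mapRight X h))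
    (g := (mapRight Y h).comp (mapLeft g V)) (fun _ _ => rfl) w

theorem rid_mapLeft {X Y : BiModule k R S} (g : Hom X Y) (w : X ⊗ᵇ regular k S) :
    rid Y (mapLeft g (regular k S) w) = g (rid X w) :=
  tensor_hom_congr (f := (rid Y).comp (mapLeft g (regular k S))) (g := g.comp (rid X))
    (fun x s => (g.map_op_smul s x).symm) w

/-- The kernel of a colinear map `f : M → W` of right comodules over a coring `D` that is flat as
a left `B`-module; its coaction is the restriction of the coaction of `M`. -/
noncomputable def kerComod (hD : LeftFlat D.bimod) (f : RightComod.Hom M W) : Comod D where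
  bimod := ker f.hom
  ρ := kerCoaction hD f
  coassoc x := by
    have inj : Function.Injective (mapLeft (kerι f.hom) (D.bimod ⊗ᵇ D.bimod)) := fun u v h => by
      rw [← assoc_assocInv _ _ _ u, ← assoc_assocInv _ _ _ v] at h ⊢
      rw [mapLeft_assoc, mapLeft_assoc] at h
      have h' := congrArg (assocInv _ _ _) h
      rw [assocInv_assoc, assocInv_assoc] at h'
      have inj₂ : Function.Injective (mapLeft (mapLeft (kerι f.hom) D.bimod) D.bimod) :=
        hD _ _ _ (mapLeft_kerι_injective hD f)
      rw [inj₂ h']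
    have hc : (mapLeft (kerι f.hom) D.bimod).comp (kerCoaction hD f) = M.ρ.comp (kerι f.hom) :=
      hom_ext (kerCoaction_spec hD f)
    refine inj ?_
    rw [mapLeft_assoc, mapLeft_mapRight, kerCoaction_spec, ← mapLeft_comp, hc, mapLeft_comp,
      kerCoaction_spec, M.coassoc]
  counit x := kerι_injective f.hom (by
    rw [← rid_mapLeft, mapLeft_mapRight, kerCoaction_spec, M.counit])

theorem kerMap_colinear (hD : LeftFlat D.bimod) (f : RightComod.Hom M W) {M' W' : Comod D} (f' : RightComod.Hom M' W')
    (g : RightComod.Hom M M') (h : ∀ x, f.hom x = 0 → f'.hom (g.hom x) = 0) (x : ker f.hom) :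
    kerCoaction hD f' (kerMap f.hom f'.hom g.hom h x)
      = mapLeft (kerMap f.hom f'.hom g.hom h) D.bimod (kerCoaction hD f x) := by
  have hc : (kerι f'.hom).comp (kerMap f.hom f'.hom g.hom h) = g.hom.comp (kerι f.hom) := rfl
  refine mapLeft_kerι_injective hD f' ?_
  rw [← mapLeft_comp, hc, mapLeft_comp, kerCoaction_spec, kerCoaction_spec, kerι_kerMap,
    g.colinear]

/-- The map induced on kernels by a commutative square of colinear maps. -/
noncomputable def kerComodMap (hD : LeftFlat D.bimod) (f : RightComod.Hom M W) {M' W' : Comod D} (f' : RightComod.Hom M' W')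
    (g : RightComod.Hom M M') (h : ∀ x, f.hom x = 0 → f'.hom (g.hom x) = 0) :
    kerComod hD f ⟶ kerComod hD f' where
  hom := kerMap f.hom f'.hom g.hom h
  colinear := kerMap_colinear hD f f' g h

end kerComod

/-- `f ⊗ Y` is colinear. -/
@[reducible] def mapLeftColinear {P Q : BiModule k R A} (f : Hom P Q) (Y : RightComod A D) :
    RightComod.Hom (RightComod.tensorLeft P Y) (RightComod.tensorLeft Q Y) where
  hom := mapLeft f Y.bimod
  colinear z := by
    induction z using tensor_ind with
    | zero => simp
    | tmul p y =>
      simp only [Hom.comp_apply, mapLeft_tmul, mapRight_tmul]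
      generalize Y.ρ y = v
      induction v using tensor_ind with
      | zero => simp
      | tmul m c => rfl
      | add v w hv hw => simp only [map_add, tmul_add, hv, hw]
    | add v w hv hw => simp only [map_add, hv, hw]

theorem omega_colinear_aux (N : BiModule k R A) (Y : Bicomod C D) (v : N ⊗ᵇ C.bimod)
    (w : Y.bimod ⊗ᵇ D.bimod) :
    assocInv _ _ _ (mapRight N (assocInv C.bimod Y.bimod D.bimod) (assoc _ _ _ (v ⊠ w)))
      = mapLeft (assoc N C.bimod Y.bimod) D.bimod (assocInv _ _ _ (v ⊠ w)) := by
  induction w using tensor_ind with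
  | zero => simp
  | tmul y d =>
    induction v using tensor_ind with
    | zero => simp
    | tmul n c => rfl
    | add v w hv hw => simp only [map_add, add_tmul, hv, hw]
  | add v w hv hw => simp only [map_add, tmul_add, hv, hw]

theorem omega_colinear (N : RightComod R C) (Y : Bicomod C D) (z : N.bimod ⊗ᵇ Y.bimod) :
    assocInv _ _ _ (mapRight N.bimod ((assocInv C.bimod Y.bimod D.bimod).comp
        (mapRight C.bimod Y.ρ)) (omega N Y.toLeftComod z))
      = mapLeft (omega N Y.toLeftComod) D.bimod (assocInv _ _ _ (mapRight N.bimod Y.ρ z)) := by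
  induction z using tensor_ind with
  | zero => simp
  | tmul n y =>
    rw [omega, mapLeft_sub, Hom.sub_apply, map_sub, map_sub]
    congr 1
    · simp only [Hom.comp_apply, mapLeft_tmul, mapRight_tmul]
      have h₁ : ∀ v : N.bimod ⊗ᵇ C.bimod,
          mapRight N.bimod ((assocInv C.bimod Y.bimod D.bimod).comp (mapRight C.bimod Y.ρ))
            (assoc _ _ _ (v ⊠ y))
          = mapRight N.bimod (assocInv C.bimod Y.bimod D.bimod) (assoc _ _ _ (v ⊠ Y.ρ y)) :=
          fun v => by
        induction v using tensor_ind with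
        | zero => simp
        | tmul n c => rfl
        | add v w hv hw => simp only [map_add, add_tmul, hv, hw]
      rw [h₁, omega_colinear_aux]
      generalize Y.ρ y = w
      induction w using tensor_ind with
      | zero => simp
      | tmul y d => rfl
      | add v w hv hw => simp only [map_add, tmul_add, hv, hw]
    · simp only [mapRight_tmul, Hom.comp_apply]
      rw [← Y.compat, assocInv_assoc]
      generalize Y.ρ y = v
      induction v using tensor_ind with
      | zero => simp
      | tmul m c => rfl
      | add v w hv hw => simp only [map_add, tmul_add, hv, hw]
  | add v w hv hw => simp only [map_add, hv, hw]

/-- For a `(C, D)`-bicomodule `Y`, the map `ω` is right `D`-colinear. -/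
@[reducible] def omegaColinear (N : RightComod R C) (Y : Bicomod C D) :
    RightComod.Hom (RightComod.tensorLeft N.bimod Y.toRightComod)
      (RightComod.tensorLeft N.bimod (RightComod.tensorLeft C.bimod Y.toRightComod)) where
  hom := omega N Y.toLeftComod
  colinear := omega_colinear N Y

/-- The functor `N ↦ N □_C Y` from right `C`-comodules to right `D`-comodules given by a
`(C, D)`-bicomodule `Y`, for `D` flat as a left `B`-module.  The coaction on `N □_C Y` is the
restriction of the coaction `N ⊗ ρ` of `N ⊗_A Y`. -/
noncomputable def cotensorComodFunctor (hD : LeftFlat D.bimod) (Y : Bicomod C D) :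
    Comod C ⥤ Comod D where
  obj N := kerComod hD (omegaColinear N Y)
  map {N N'} f := kerComodMap hD (omegaColinear N Y) (omegaColinear N' Y)
    (mapLeftColinear f.hom Y.toRightComod)
    (fun x hx => by
      exact (omega_naturality f Y.toLeftComod x).trans ((congrArg _ hx).trans (map_zero _)))
  map_id N := RightComod.hom_ext fun x =>
    kerι_injective (omega N Y.toLeftComod) (mapLeft_id _ _)
  map_comp {N N' N''} f g := RightComod.hom_ext fun x =>
    kerι_injective (omega N'' Y.toLeftComod) (mapLeft_comp _ _ _ _)

end cotensor

/-! ## Module-morphisms, push-out and pull-back functors -/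

/-- A `((D : B), (C : A))`-module-morphism `(Σ, σ)`: a `(B, A)`-bimodule `Σ`, finitely generated
and projective as a right `A`-module, and a morphism `σ : Σ[D] → C` of `A`-corings. -/
structure ModuleMorphism (D : Coring k B) (C : Coring k A) where
  bimod : BiModule k B A
  [fgp : RightFGP bimod]
  σ : CoringHom (baseExt D bimod) C

attribute [instance] ModuleMorphism.fgp

namespace ModuleMorphism

variable {C : Coring k A} {D : Coring k B} (Φ : ModuleMorphism D C)

theorem spread_naturality {M M' : BiModule k R B} (f : Hom M M') (X : BiModule k B A)
    [RightFGP X] (V : BiModule k B T) (y : M ⊗ᵇ V) : spread M' X V (mapLeft f V y)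
      = mapLeft (mapLeft f X) (X.dual ⊗ᵇ V) (spread M X V y) := by
  induction y using tensor_ind with
  | zero => simp
  | tmul m d => simp only [mapLeft_tmul, spread_tmul, map_sum]
  | add v w hv hw => simp only [map_add, hv, hw]

theorem pushCoaction_naturality {M M' : RightComod R D} (f : M ⟶ M') (X : BiModule k B A)
    [RightFGP X] (z : M.bimod ⊗ᵇ X) : pushCoaction X M' (mapLeft f.hom X z)
      = mapLeft (mapLeft f.hom X) (baseExtBimod D X) (pushCoaction X M z) := by
  induction z using tensor_ind with
  | zero => simp
  | tmul m x =>
    rw [mapLeft_tmul, pushCoaction_tmul, pushCoaction_tmul, eta_apply, eta_apply, f.colinear,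
      spread_naturality, mapLeft_assoc, mapLeft_tmul]
  | add v w hv hw => simp only [map_add, hv, hw]

theorem push_colinear {M M' : RightComod R D} (f : M ⟶ M') (z : M.bimod ⊗ᵇ Φ.bimod) :
    ((mapRight (M'.bimod ⊗ᵇ Φ.bimod) Φ.σ.hom).comp (pushCoaction Φ.bimod M'))
        (mapLeft f.hom Φ.bimod z)
      = mapLeft (mapLeft f.hom Φ.bimod) C.bimod
        (((mapRight (M.bimod ⊗ᵇ Φ.bimod) Φ.σ.hom).comp (pushCoaction Φ.bimod M)) z) := by
  exact (congrArg (mapRight _ Φ.σ.hom) (pushCoaction_naturality f Φ.bimod z)).trans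
    (mapLeft_mapRight _ _ _).symm

/-- The push-out functor `M ↦ M ⊗_B Σ`, with coaction
`m ⊗ s ↦ ∑ i, (m₀ ⊗ e i) ⊗ σ(e* i ⊗ m₁ ⊗ s)`. -/
noncomputable def pushOut : Comod D ⥤ Comod C where
  obj M := (M.tensorBase Φ.bimod).corestrict Φ.σ
  map f :=
    { hom := mapLeft f.hom Φ.bimod
      colinear := push_colinear Φ f }
  map_id _ := RightComod.hom_ext fun _ => mapLeft_id _ _
  map_comp _ _ := RightComod.hom_ext fun _ => mapLeft_comp _ _ _ _

/-- The `(C, D)`-bicomodule `Σ^* ⊗_B D`, with left coaction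
`f ⊗ d ↦ ∑ i, σ(f ⊗ d₁ ⊗ e i) ⊗ (e* i ⊗ d₂)` and right coaction `Σ^* ⊗ Δ`. -/
noncomputable def dualBicomod : Bicomod C D := (BimCoring.dualBicomod D Φ.bimod).corestrict Φ.σ

/-- The pull-back functor `N ↦ N □_C (Σ^* ⊗_B D)`, for `D` flat as a left `B`-module. -/
noncomputable def pullBack (hD : LeftFlat D.bimod) : Comod C ⥤ Comod D :=
  cotensorComodFunctor hD Φ.dualBicomod

/-- The left `D`-comodule `D ⊗_B Σ`, with coaction `Δ ⊗ Σ`. -/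
def leftComod : LeftComod D A := LeftComod.free D Φ.bimod

end ModuleMorphism

end BimCoring

/-! Without any condition on `σ` beyond its being a coring morphism, `Σ_∘` is left adjoint to `Σ^∘`.
The unit is `m ↦ ∑ (m₀ ⊗ e i) ⊗ (e* i ⊗ m₁)`, and the counit is `(n ⊗ f ⊗ d) ⊗ x ↦ n f(ε(d) x)`
restricted to the cotensor product (`adjunction`). The theorem is a study of when these two maps are
bijective.

Two translations make coflatness usable. The coaction of `M` identifies `M ⊗_B X` with `M □_D (D ⊗_B
X)` (`cotensorFree_bijective`), so `D ⊗_B Σ` is faithfully coflat exactly when `- ⊗_B Σ` preserves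
and reflects exactness of sequences of `D`-comodules (`TensorExact`). Over a flat coring, exactness
in the comodule category is exactness of the underlying groups (`comod_exact_iff`).

(a) ⇒ (b). Through `N ⊗ σ`, the map `ω ⊗ Σ` for `Σ^* ⊗ D` becomes the map `ω` for `C`
(`tensorσ_dualOmega`), whose kernel is `N □_C C ≅ N`. Since `- ⊗ Σ` preserves the kernel of `ω`, the
counit is bijective. A triangle identity then makes the unit bijective after tensoring with `Σ`, and
reflection of exactness removes the `Σ`. Flatness of `C ≅ Σ^* ⊗ D ⊗ Σ` is obtained one tensor factor
at a time.

(b) ⇒ (a). If `Σ_∘` is an equivalence, the counit of the adjunction is invertible. At `N = C` the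
coaction identifies `C □_C (Σ^* ⊗ D)` with `Σ^* ⊗ D`, and under this identification the counit is
`σ` itself (`counitHom_lamSelf`), so `σ` is bijective. An equivalence preserves and reflects
exactness, and flatness of `C` turns exactness of the image in `M^C` into exactness of the
underlying groups of `E ⊗_B Σ`. -/

namespace BimCoring

open BiModule

variable {k : Type u} [CommRing k]
  {R : Type u} [Ring R] [Algebra k R] {S : Type u} [Ring S] [Algebra k S]
  {T : Type u} [Ring T] [Algebra k T] {U : Type u} [Ring U] [Algebra k U]
  {A : Type u} [Ring A] [Algebra k A] {B : Type u} [Ring B] [Algebra k B]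

namespace BiModule

/-! ### Cokernels of bimodule maps -/

/-- The group underlying the cokernel of a bimodule map. -/
def CokerCarrier {P W : BiModule k R S} (f : Hom P W) : Type u := W ⧸ rangeSubmodule f

instance {P W : BiModule k R S} (f : Hom P W) : AddCommGroup (CokerCarrier f) :=
  inferInstanceAs (AddCommGroup (W ⧸ rangeSubmodule f))

instance {P W : BiModule k R S} (f : Hom P W) : Module R (CokerCarrier f) :=
  inferInstanceAs (Module R (W ⧸ rangeSubmodule f))

/-- The right action of `s` on `W`, as a left linear map. -/
def opSMulLinear (W : BiModule k R S) (s : Sᵐᵒᵖ) : W →ₗ[R] W where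
  toFun x := s • x
  map_add' := smul_add s
  map_smul' r x := (smul_comm r s x).symm

/-- The right action on the cokernel. -/
def cokerOpSMul {P W : BiModule k R S} (f : Hom P W) (s : Sᵐᵒᵖ) :
    CokerCarrier f →ₗ[R] CokerCarrier f :=
  (rangeSubmodule f).mapQ (rangeSubmodule f) (opSMulLinear W s) fun x hx =>
    op_smul_mem_range f s ⟨x, hx⟩

theorem cokerCarrier_ind {P W : BiModule k R S} (f : Hom P W) {p : CokerCarrier f → Prop}
    (h : ∀ w : W, p ((rangeSubmodule f).mkQ w)) (x : CokerCarrier f) : p x :=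
  Submodule.Quotient.induction_on (rangeSubmodule f) x h

instance {P W : BiModule k R S} (f : Hom P W) : Module Sᵐᵒᵖ (CokerCarrier f) where
  smul s x := cokerOpSMul f s x
  one_smul := cokerCarrier_ind f fun w =>
    congrArg (rangeSubmodule f).mkQ (one_smul Sᵐᵒᵖ w)
  mul_smul s t := cokerCarrier_ind f fun w =>
    congrArg (rangeSubmodule f).mkQ (mul_smul s t w)
  smul_zero s := map_zero (cokerOpSMul f s)
  smul_add s := map_add (cokerOpSMul f s)
  add_smul s t := cokerCarrier_ind f fun w =>
    congrArg (rangeSubmodule f).mkQ (add_smul s t w)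
  zero_smul := cokerCarrier_ind f fun w =>
    congrArg (rangeSubmodule f).mkQ (zero_smul Sᵐᵒᵖ w)

/-- The cokernel of a bimodule map. -/
def coker {P W : BiModule k R S} (f : Hom P W) : BiModule k R S where
  carrier := CokerCarrier f
  smulComm := ⟨fun r s => cokerCarrier_ind f fun w =>
    congrArg (rangeSubmodule f).mkQ (smul_comm r s w)⟩
  central r := cokerCarrier_ind f fun w => congrArg (rangeSubmodule f).mkQ (W.central r w)

/-- The projection to the cokernel. -/
def cokerπ {P W : BiModule k R S} (f : Hom P W) : Hom W (coker f) where
  toFun w := (rangeSubmodule f).mkQ w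
  map_add' _ _ := rfl
  map_smul' _ _ := rfl
  map_op_smul' _ _ := rfl

theorem cokerπ_surjective {P W : BiModule k R S} (f : Hom P W) :
    Function.Surjective (cokerπ f) :=
  Submodule.mkQ_surjective (rangeSubmodule f)

theorem cokerπ_eq_zero {P W : BiModule k R S} (f : Hom P W) (w : W) :
    cokerπ f w = 0 ↔ ∃ x, f x = w :=
  Submodule.Quotient.mk_eq_zero (rangeSubmodule f)

/-- The map out of the cokernel of `f` induced by a map that vanishes on the range of `f`. -/
def cokerDesc {P W Z : BiModule k R S} (f : Hom P W) (g : Hom W Z) (h : ∀ x, g (f x) = 0) :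
    Hom (coker f) Z where
  toFun := (rangeSubmodule f).liftQ
    ({ toFun := g, map_add' := map_add g, map_smul' := g.map_smul } : W →ₗ[R] Z)
    (by rintro _ ⟨x, rfl⟩; exact h x)
  map_add' := map_add _
  map_smul' := map_smul _
  map_op_smul' s := cokerCarrier_ind f fun w => g.map_op_smul s w

@[simp] theorem cokerDesc_cokerπ {P W Z : BiModule k R S} (f : Hom P W) (g : Hom W Z)
    (h : ∀ x, g (f x) = 0) (w : W) : cokerDesc f g h (cokerπ f w) = g w := rfl

/-- A map that is killed by `f` factors through the kernel of `f`. -/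
def kerLift {P M W : BiModule k R S} (f : Hom M W) (g : Hom P M) (hg : ∀ x, f (g x) = 0) :
    Hom P (ker f) where
  toFun x := kerMk f (g x) (hg x)
  map_add' x y := kerι_injective f (map_add g x y)
  map_smul' r x := kerι_injective f (g.map_smul r x)
  map_op_smul' s x := kerι_injective f (g.map_op_smul s x)

/-- The zero bimodule. -/
def zeroBiModule : BiModule k R S where
  carrier := PUnit
  central _ _ := rfl

end BiModule

/-! ## Exactness in the category of comodules -/

section exact

variable {D : Coring k B}

/-- Colinearity moves `f` past the coaction, where it meets `cokerπ f ⊗ D` and dies. Hence the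
coaction descends to the cokernel over any coring, whereas its restriction to a kernel requires
flatness. -/
theorem cokerCoaction_aux {M W : RightComod R D} (f : RightComod.Hom M W) (x : M.bimod) :
    (mapLeft (cokerπ f.hom) D.bimod).comp W.ρ (f.hom x) = 0 := by
  have h : (cokerπ f.hom).comp f.hom = Hom.zero _ _ :=
    hom_ext fun x => (cokerπ_eq_zero f.hom _).2 ⟨x, rfl⟩
  rw [Hom.comp_apply, f.colinear, ← mapLeft_comp, h, mapLeft_zero]

/-- The cokernel of a colinear map. -/
def cokerComod {M W : RightComod R D} (f : RightComod.Hom M W) : RightComod R D where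
  bimod := coker f.hom
  ρ := cokerDesc f.hom ((mapLeft (cokerπ f.hom) D.bimod).comp W.ρ) (cokerCoaction_aux f)
  coassoc x := by
    obtain ⟨w, rfl⟩ := cokerπ_surjective f.hom x
    have hc : (cokerDesc f.hom ((mapLeft (cokerπ f.hom) D.bimod).comp W.ρ)
        (cokerCoaction_aux f)).comp (cokerπ f.hom) = (mapLeft (cokerπ f.hom) D.bimod).comp W.ρ :=
      hom_ext fun _ => rfl
    rw [cokerDesc_cokerπ, Hom.comp_apply, ← mapLeft_comp, hc, mapLeft_comp, ← mapLeft_mapRight,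
      ← W.coassoc, mapLeft_assoc]
  counit x := by
    obtain ⟨w, rfl⟩ := cokerπ_surjective f.hom x
    rw [cokerDesc_cokerπ, Hom.comp_apply, ← mapLeft_mapRight, rid_mapLeft, W.counit]

/-- The projection to the cokernel, as a colinear map. -/
def cokerComodπ {M W : RightComod R D} (f : M ⟶ W) : W ⟶ cokerComod f where
  hom := cokerπ f.hom
  colinear _ := rfl

theorem comp_cokerComodπ {M W : RightComod R D} (f : M ⟶ W) : f ≫ cokerComodπ f = 0 :=
  RightComod.hom_ext fun x => (cokerπ_eq_zero f.hom _).2 ⟨x, rfl⟩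

/-- `cokerComodπ f` is a cokernel of `f`. -/
def cokerComodIsColimit {M W : RightComod R D} (f : M ⟶ W) :
    Limits.IsColimit (Limits.CokernelCofork.ofπ (cokerComodπ f) (comp_cokerComodπ f)) :=
  Limits.CokernelCofork.IsColimit.ofπ _ _
    (fun g hg =>
      { hom := cokerDesc f.hom g.hom fun x => congrArg (fun h : M ⟶ _ => h.hom x) hg
        colinear := fun x => by
          obtain ⟨w, rfl⟩ := cokerπ_surjective f.hom x
          have hc : (cokerDesc f.hom g.hom fun x => congrArg (fun h : M ⟶ _ => h.hom x) hg).comp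
              (cokerπ f.hom) = g.hom := rfl
          refine (g.colinear w).trans ?_
          conv_lhs => rw [← hc, mapLeft_comp]
          rfl })
    (fun _ _ => rfl)
    (fun g hg m hm => RightComod.hom_ext fun x => by
      obtain ⟨w, rfl⟩ := cokerπ_surjective f.hom x
      exact congrArg (fun h : W ⟶ _ => h.hom w) hm)

/-- The inclusion of the kernel, as a colinear map. -/
noncomputable def kerComodι (hD : LeftFlat D.bimod) {M W : Comod D} (f : M ⟶ W) :
    kerComod hD f ⟶ M where
  hom := kerι f.hom
  colinear x := (kerCoaction_spec hD f x).symm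

theorem kerComodι_comp (hD : LeftFlat D.bimod) {M W : Comod D} (f : M ⟶ W) :
    kerComodι hD f ≫ f = 0 :=
  RightComod.hom_ext fun x => apply_kerι f.hom x

/-- A colinear map that is killed by `f` factors through the kernel of `f`. -/
noncomputable def kerComodLift (hD : LeftFlat D.bimod) {M W P : Comod D} (f : M ⟶ W) (g : P ⟶ M)
    (hg : ∀ x, f.hom (g.hom x) = 0) : P ⟶ kerComod hD f where
  hom := kerLift f.hom g.hom hg
  colinear x := by
    have hc : (kerι f.hom).comp (kerLift f.hom g.hom hg) = g.hom := rfl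
    have h : mapLeft (kerι f.hom) D.bimod (mapLeft (kerLift f.hom g.hom hg) D.bimod (P.ρ x))
        = M.ρ (g.hom x) := by
      rw [← mapLeft_comp, hc, g.colinear]
    exact mapLeft_kerι_injective hD f ((kerCoaction_spec hD f _).trans h.symm)

/-- `kerComodι f` is a kernel of `f`. -/
noncomputable def kerComodIsLimit (hD : LeftFlat D.bimod) {M W : Comod D} (f : M ⟶ W) :
    Limits.IsLimit (Limits.KernelFork.ofι (kerComodι hD f) (kerComodι_comp hD f)) :=
  Limits.KernelFork.IsLimit.ofι _ _
    (fun g hg => kerComodLift hD f g fun x => congrArg (fun h : _ ⟶ W => h.hom x) hg)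
    (fun _ _ => rfl)
    (fun _ _ _ hm => RightComod.hom_ext fun x => kerι_injective f.hom
      (congrArg (fun h : _ ⟶ M => h.hom x) hm))

/-- The zero comodule. -/
def zeroComod (D : Coring k B) : RightComod R D where
  bimod := zeroBiModule
  ρ := Hom.zero _ _
  coassoc _ := by simp
  counit _ := rfl

theorem isZero_of_subsingleton (M : RightComod R D) [Subsingleton M.bimod] :
    Limits.IsZero M :=
  (Limits.IsZero.iff_id_eq_zero M).2 (RightComod.hom_ext fun _ => Subsingleton.elim _ _)

theorem isZero_zeroComod : Limits.IsZero (zeroComod D : RightComod R D) :=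
  have : Subsingleton (zeroComod D : RightComod R D).bimod := inferInstanceAs (Subsingleton PUnit)
  isZero_of_subsingleton _

theorem epi_of_surjective {M W : RightComod R D} (f : M ⟶ W) (hf : Function.Surjective f.hom) :
    Epi f :=
  ⟨fun _ _ w => RightComod.hom_ext fun x => by
    obtain ⟨y, rfl⟩ := hf x
    exact congrArg (fun h : M ⟶ _ => h.hom y) w⟩

theorem mono_of_injective {M W : RightComod R D} (f : M ⟶ W) (hf : Function.Injective f.hom) :
    Mono f :=
  ⟨fun _ _ w => RightComod.hom_ext fun x => hf (congrArg (fun h : _ ⟶ W => h.hom x) w)⟩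

/-- Over a flat coring, exactness of comodules is exactness of the underlying groups. -/
theorem comod_exact_iff (hD : LeftFlat D.bimod) (E : ShortComplex (Comod D)) :
    E.Exact ↔ ∀ x, E.g.hom x = 0 → ∃ y, E.f.hom y = x := by
  constructor
  · rintro ⟨h, hz⟩ x hx
    -- The projection to the cokernel of `f' : X₁ ⟶ K` factors through the homology, which is zero;
    -- so `f'` is surjective onto the abstract kernel `K`.
    have hq : cokerComodπ h.left.f' = 0 := by
      rw [← Limits.Cofork.IsColimit.π_desc' h.left.hπ (cokerComodπ h.left.f')
        ((comp_cokerComodπ _).trans Limits.zero_comp.symm)]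
      exact (congrArg (· ≫ _) (hz.eq_of_tgt h.left.π 0)).trans Limits.zero_comp
    -- Comparison of the concrete kernel with `K`: the element `x` is carried to `K`, lifted along
    -- `f'`, and read back in `X₂`.
    let l := h.left.hi.lift (Limits.KernelFork.ofι _ (kerComodι_comp hD E.g))
    have hl : l ≫ h.left.i = kerComodι hD E.g :=
      h.left.hi.fac _ Limits.WalkingParallelPair.zero
    obtain ⟨y, hy⟩ := (cokerπ_eq_zero h.left.f'.hom (l.hom (kerMk E.g.hom x hx))).1
      (congrArg (fun t : h.left.K ⟶ _ => t.hom (l.hom (kerMk E.g.hom x hx))) hq)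
    refine ⟨y, ?_⟩
    have h₁ := congrArg (fun t : kerComod hD E.g ⟶ _ => t.hom (kerMk E.g.hom x hx)) hl
    have h₂ := congrArg (fun t : E.X₁ ⟶ _ => t.hom y) h.left.f'_i
    exact h₂.symm.trans ((congrArg h.left.i.hom hy).trans h₁)
  · intro h
    -- The hypothesis says both that `X₁ → ker g` is surjective and that `coker f → X₃` is
    -- injective. The first makes the left homology zero, the second the right homology.
    let f' := kerComodLift hD E.g E.f fun x => congrArg (fun t : _ ⟶ E.X₃ => t.hom x) E.zero
    have hf' : Function.Surjective f'.hom := fun x => by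
      obtain ⟨y, hy⟩ := h (kerι E.g.hom x) (apply_kerι _ _)
      exact ⟨y, kerι_injective E.g.hom hy⟩
    let g' := (cokerComodIsColimit E.f).desc (Limits.CokernelCofork.ofπ _ E.zero)
    have hg' : cokerComodπ E.f ≫ g' = E.g :=
      (cokerComodIsColimit E.f).fac _ Limits.WalkingParallelPair.one
    have hg : Function.Injective g'.hom := (injective_iff_map_eq_zero _).2 fun x hx => by
      obtain ⟨w, rfl⟩ := cokerπ_surjective E.f.hom x
      have := congrArg (fun t : E.X₂ ⟶ _ => t.hom w) hg'
      exact (cokerπ_eq_zero E.f.hom w).2 (h w (this.symm.trans hx))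
    have := epi_of_surjective f' hf'
    have := mono_of_injective g' hg
    let L : E.LeftHomologyData :=
      { K := kerComod hD E.g
        H := zeroComod D
        i := kerComodι hD E.g
        π := 0
        wi := kerComodι_comp hD E.g
        hi := kerComodIsLimit hD E.g
        wπ := Limits.comp_zero
        hπ := Limits.CokernelCofork.IsColimit.ofEpiOfIsZero _ ‹Epi f'› isZero_zeroComod }
    let Q : E.RightHomologyData :=
      { Q := cokerComod E.f
        H := zeroComod D
        p := cokerComodπ E.f
        ι := 0
        wp := comp_cokerComodπ E.f
        hp := cokerComodIsColimit E.f
        wι := Limits.zero_comp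
        hι := Limits.KernelFork.IsLimit.ofMonoOfIsZero _ ‹Mono g'› isZero_zeroComod }
    refine ⟨⟨L, Q, Iso.refl _, ?_⟩, isZero_zeroComod⟩
    -- With both homologies zero, compatibility of the left and right data reduces to the vanishing
    -- of `ker g → coker f`.
    refine RightComod.hom_ext fun x => ?_
    exact ((cokerπ_eq_zero E.f.hom _).2 (h _ (apply_kerι E.g.hom x))).symm

end exact

/-! ## The adjunction between push-out and pull-back -/

theorem mapRight_comp (X : BiModule k R S) {Y Z W : BiModule k S T} (g : Hom Z W) (f : Hom Y Z)
    (w : X ⊗ᵇ Y) : mapRight X (g.comp f) w = mapRight X g (mapRight X f w) :=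
  tensor_hom_congr (f := mapRight X (g.comp f)) (g := (mapRight X g).comp (mapRight X f))
    (fun _ _ => rfl) w

theorem assoc_mapLeft_mapRight (V : BiModule k R S) {P Q : BiModule k S T} (g : Hom P Q)
    (Y : BiModule k T U) (v : V ⊗ᵇ P ⊗ᵇ Y) :
    assoc V Q Y (mapLeft (mapRight V g) Y v) = mapRight V (mapLeft g Y) (assoc V P Y v) :=
  tensor_hom_congr₃ (f := (assoc V Q Y).comp (mapLeft (mapRight V g) Y))
    (g := (mapRight V (mapLeft g Y)).comp (assoc V P Y)) (fun _ _ _ => rfl) v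

/-- An element `w` of `N □_C C` is the coaction of `(N ⊗ ε) w`. -/
theorem coaction_rid_counit {C : Coring k A} (N : RightComod R C) (w : N.bimod ⊗ᵇ C.bimod)
    (hw : assoc _ _ _ (mapLeft N.ρ C.bimod w) = mapRight N.bimod C.Δ w) :
    N.ρ (rid _ (mapRight N.bimod C.ε w)) = w := by
  -- `P = N ⊗ (C ⊗ ε)` is applied to both sides of `hw`: the side with `Δ` returns `w` by the right
  -- counit law, and the side with `ρ` gives the coaction of `(N ⊗ ε) w` by right linearity of `ρ`.
  let P := mapRight N.bimod ((rid C.bimod).comp (mapRight C.bimod C.ε))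
  have h₁ : P (mapRight N.bimod C.Δ w) = w :=
    tensor_hom_congr (f := P.comp (mapRight N.bimod C.Δ)) (g := Hom.id _)
      (fun n c => congrArg (fun c => n ⊠ c) (C.counit_right c)) w
  have h₂ : P (assoc _ _ _ (mapLeft N.ρ C.bimod w)) = N.ρ (rid _ (mapRight N.bimod C.ε w)) := by
    refine tensor_hom_congr (f := P.comp ((assoc _ _ _).comp (mapLeft N.ρ C.bimod)))
      (g := N.ρ.comp ((rid _).comp (mapRight N.bimod C.ε))) (fun n c => ?_) w
    have h : ∀ v : N.bimod ⊗ᵇ C.bimod, P (assoc _ _ _ (v ⊠ c)) = op (show A from C.ε c) • v :=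
        fun v => by
      induction v using tensor_ind with
      | zero => simp
      | tmul n c => rfl
      | add v w hv hw => simp only [map_add, add_tmul, smul_add, hv, hw]
    exact (h _).trans (N.ρ.map_op_smul _ _).symm
  rw [← h₂, hw, h₁]

/-! ### Maps induced by `σ`, and comparison of the two maps `ω`. -/

namespace ModuleMorphism

variable {C : Coring k A} {D : Coring k B} (Φ : ModuleMorphism D C)

/-- The left `C`-coaction of `Σ^* ⊗_B D`. -/
noncomputable def dualLam :
    Hom (Φ.bimod.dual ⊗ᵇ D.bimod) (C.bimod ⊗ᵇ (Φ.bimod.dual ⊗ᵇ D.bimod)) :=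
  (mapLeft Φ.σ.hom (Φ.bimod.dual ⊗ᵇ D.bimod)).comp (baseExtLam D Φ.bimod)

/-- The map `ω` for the bicomodule `Σ^* ⊗_B D`. -/
noncomputable def dualOmega (N : RightComod R C) :
    Hom (N.bimod ⊗ᵇ (Φ.bimod.dual ⊗ᵇ D.bimod))
      (N.bimod ⊗ᵇ (C.bimod ⊗ᵇ (Φ.bimod.dual ⊗ᵇ D.bimod))) :=
  omega N Φ.dualBicomod.toLeftComod

theorem dualOmega_apply (N : RightComod R C) (z : N.bimod ⊗ᵇ (Φ.bimod.dual ⊗ᵇ D.bimod)) :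
    Φ.dualOmega N z = assoc _ _ _ (mapLeft N.ρ (Φ.bimod.dual ⊗ᵇ D.bimod) z)
      - mapRight N.bimod Φ.dualLam z := rfl

/-- The map `N ⊗ (Σ^* ⊗ D) ⊗ Σ → N ⊗ C` induced by `σ`. -/
noncomputable def tensorσ (N : BiModule k R A) :
    Hom (N ⊗ᵇ (Φ.bimod.dual ⊗ᵇ D.bimod) ⊗ᵇ Φ.bimod) (N ⊗ᵇ C.bimod) :=
  (mapRight N Φ.σ.hom).comp (assoc N (Φ.bimod.dual ⊗ᵇ D.bimod) Φ.bimod)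

/-- The map `N ⊗ (Σ^* ⊗ D) ⊗ Σ → N`, `n ⊗ f ⊗ d ⊗ x ↦ n f(ε(d) x)`. -/
noncomputable def tensorEv (N : BiModule k R A) :
    Hom (N ⊗ᵇ (Φ.bimod.dual ⊗ᵇ D.bimod) ⊗ᵇ Φ.bimod) N :=
  (rid N).comp ((mapRight N C.ε).comp (Φ.tensorσ N))

/-- `σ` preserves counits, so `ε ∘ σ` is the counit of `Σ[D]`, whose formula no longer involves `σ`.
-/
theorem tensorEv_tmul (N : BiModule k R A) (n : N) (f : Φ.bimod.dual) (d : D.bimod)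
    (x : Φ.bimod) : Φ.tensorEv N (n ⊠ (f ⊠ d) ⊠ x)
      = op (f ((show B from D.ε d) • x)) • n := by
  have h := Φ.σ.counit (f ⊠ d ⊠ x)
  exact congrArg (fun a : A => op a • n) h

theorem tensorEv_naturality {N N' : BiModule k R A} (f : Hom N N')
    (z : N ⊗ᵇ (Φ.bimod.dual ⊗ᵇ D.bimod) ⊗ᵇ Φ.bimod) :
    Φ.tensorEv N' (mapLeft (mapLeft f _) _ z) = f (Φ.tensorEv N z) :=
  tensor_hom_congr₃ (f := (Φ.tensorEv N').comp (mapLeft (mapLeft f _) _))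
    (g := f.comp (Φ.tensorEv N)) (fun _ _ _ => (f.map_op_smul _ _).symm) z

/-- The coproduct of `Σ[D]` is the left coaction of `Σ^* ⊗ D` tensored with `Σ`. Splitting `σ ⊗ σ`
into its two factors, the first turns this coaction into the `C`-coaction `dualLam`, and the second
is `tensorσ`. -/
theorem comul_σ (y : Φ.bimod.dual ⊗ᵇ D.bimod) (x : Φ.bimod) :
    C.Δ (Φ.σ.hom (y ⊠ x)) = Φ.tensorσ C.bimod (Φ.dualLam y ⊠ x) := by
  refine (Φ.σ.comul (y ⊠ x)).trans ?_
  change map Φ.σ.hom Φ.σ.hom (assoc _ _ _ (baseExtLam D Φ.bimod y ⊠ x))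
    = Φ.tensorσ C.bimod (mapLeft Φ.σ.hom _ (baseExtLam D Φ.bimod y) ⊠ x)
  generalize baseExtLam D Φ.bimod y = v
  induction v using tensor_ind with
  | zero => simp
  | tmul n c => rfl
  | add v w hv hw => simp only [map_add, add_tmul, hv, hw]

/-- The comparison of `ω` for `Σ^* ⊗ D` and for `C`. -/
theorem tensorσ_dualOmega (N : RightComod R C)
    (z : N.bimod ⊗ᵇ (Φ.bimod.dual ⊗ᵇ D.bimod) ⊗ᵇ Φ.bimod) :
    mapRight N.bimod (Φ.tensorσ C.bimod) (assoc _ _ _ (mapLeft (Φ.dualOmega N) Φ.bimod z))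
      = assoc _ _ _ (mapLeft N.ρ C.bimod (Φ.tensorσ N.bimod z))
        - mapRight N.bimod C.Δ (Φ.tensorσ N.bimod z) := by
  refine tensor_hom_congr₃
    (f := (mapRight N.bimod (Φ.tensorσ C.bimod)).comp
      ((assoc _ _ _).comp (mapLeft (Φ.dualOmega N) Φ.bimod)))
    (g := (((assoc _ _ _).comp (mapLeft N.ρ C.bimod)).comp (Φ.tensorσ N.bimod)).sub
        ((mapRight N.bimod C.Δ).comp (Φ.tensorσ N.bimod))) (fun n y x => ?_) z
  simp only [Hom.comp_apply, Hom.sub_apply, mapLeft_tmul, dualOmega_apply, sub_tmul, map_sub]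
  congr 1
  · refine Eq.trans (b := assoc _ _ _ (N.ρ n ⊠ Φ.σ.hom (y ⊠ x))) ?_ rfl
    generalize N.ρ n = v
    induction v using tensor_ind with
    | zero => simp
    | tmul n c => rfl
    | add v w hv hw => simp only [map_add, add_tmul, hv, hw]
  -- The terms with `ρ` agree for formal reasons; only here does compatibility of `σ` with the
  -- coproducts enter.
  · exact (congrArg (fun c => n ⊠ c) (Φ.comul_σ y x)).symm

/-- By `tensorσ_dualOmega`, `N ⊗ σ` carries an element killed by `ω ⊗ Σ` into `N □_C C`, and every
element there is the coaction of its image under `N ⊗ ε`. -/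
theorem coaction_tensorEv (N : RightComod R C)
    (z : N.bimod ⊗ᵇ (Φ.bimod.dual ⊗ᵇ D.bimod) ⊗ᵇ Φ.bimod)
    (hz : mapLeft (Φ.dualOmega N) Φ.bimod z = 0) :
    N.ρ (Φ.tensorEv N.bimod z) = Φ.tensorσ N.bimod z := by
  refine coaction_rid_counit N _ (sub_eq_zero.1 ?_)
  rw [← tensorσ_dualOmega, hz, map_zero, map_zero]

/-- The coaction of `N ⊗ (Σ^* ⊗ D)`, spread out over `Σ ⊗ Σ^*` and evaluated, is the identity. -/
theorem tensorEv_spread (N : BiModule k R A) (w : N ⊗ᵇ (Φ.bimod.dual ⊗ᵇ D.bimod)) :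
    mapLeft (Φ.tensorEv N) (Φ.bimod.dual ⊗ᵇ D.bimod) (spread _ Φ.bimod D.bimod
      ((RightComod.tensorLeft N (dualTensor D Φ.bimod)).ρ w)) = w := by
  refine tensor_hom_congr (f := (mapLeft (Φ.tensorEv N) (Φ.bimod.dual ⊗ᵇ D.bimod)).comp
    ((spread _ Φ.bimod D.bimod).comp (RightComod.tensorLeft N (dualTensor D Φ.bimod)).ρ))
    (g := Hom.id _) (fun n y => ?_) w
  induction y using tensor_ind with
  | zero => simp
  | add v w hv hw => simp only [map_add, tmul_add, hv, hw]
  | tmul f d =>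
    -- With `Δ d` replaced by an arbitrary `z`, the claim can be checked on pure tensors. There the
    -- sum over `i` is the dual basis expansion of `f · ε(d)`, so the whole composite amounts to `ε
    -- ⊗ D` on `z`, and the left counit law finishes.
    have h : ∀ z : D.bimod ⊗ᵇ D.bimod,
        mapLeft (Φ.tensorEv N) (Φ.bimod.dual ⊗ᵇ D.bimod) (spread _ Φ.bimod D.bimod
          (assocInv N (Φ.bimod.dual ⊗ᵇ D.bimod) D.bimod
            (n ⊠ assocInv Φ.bimod.dual D.bimod D.bimod (f ⊠ z))))
        = n ⊠ (f ⊠ lid _ (mapLeft D.ε D.bimod z)) := fun z => by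
      induction z using tensor_ind with
      | zero => simp
      | tmul d d' =>
        simp only [assocInv_tmul, spread_tmul, map_sum, mapLeft_tmul, tensorEv_tmul,
          tmul_balanced, smul_tmul]
        rw [← tmul_sum, ← sum_tmul]
        refine congrArg (fun y => n ⊠ y) (Eq.trans ?_ (tmul_balanced f (show B from D.ε d) d'))
        exact congrArg (fun f => f ⊠ d')
          (Φ.bimod.dualBasis.sum_dual_eq (op (show B from D.ε d) • f))
      | add v w hv hw => simp only [map_add, tmul_add, hv, hw]
    exact (h (D.Δ d)).trans (by rw [D.counit_left]; rfl)

/-- Over `Σ[D]` this is the coassociativity `eta_coassoc`; applying `σ` to the middle factor gives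
it over `C`. -/
theorem dualOmega_eta (M : RightComod R D) (m : M.bimod) :
    Φ.dualOmega ((M.tensorBase Φ.bimod).corestrict Φ.σ) (eta Φ.bimod M m) = 0 := by
  have h := congrArg (mapRight (M.bimod ⊗ᵇ Φ.bimod)
    (mapLeft Φ.σ.hom (Φ.bimod.dual ⊗ᵇ D.bimod))) (eta_coassoc Φ.bimod M m)
  rw [← assoc_mapLeft_mapRight] at h
  exact sub_eq_zero.2 ((congrArg (assoc _ _ _) (mapLeft_comp _ _ _ _)).trans
    (h.trans (mapRight_comp _ _ _ _).symm))

/-- `tensorEv` was built as `N ⊗ ε` after `N ⊗ σ`, so the composite is the coaction of the push-out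
followed by the counit of `C`. One triangle identity is therefore the counit law of the push-out. -/
theorem tensorEv_eta (M : RightComod R D) (z : M.bimod ⊗ᵇ Φ.bimod) :
    Φ.tensorEv _ (mapLeft (eta Φ.bimod M) Φ.bimod z) = z :=
  ((M.tensorBase Φ.bimod).corestrict Φ.σ).counit z

theorem eta_naturality {M M' : RightComod R D} (f : M ⟶ M') (X : BiModule k B A)
    [RightFGP X] (m : M.bimod) : eta X M' (f.hom m)
      = mapLeft (mapLeft f.hom X) (X.dual ⊗ᵇ D.bimod) (eta X M m) := by
  rw [eta_apply, eta_apply, f.colinear, spread_naturality]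

/-! ### Unit, counit and triangle identities. -/

section adjunction

variable (hD : LeftFlat D.bimod)

/-- The unit `M → (M ⊗ Σ) □_C (Σ^* ⊗ D)` of the adjunction. -/
noncomputable def unitHom (M : Comod D) : Hom M.bimod (ker (Φ.dualOmega (Φ.pushOut.obj M))) :=
  kerLift _ (eta Φ.bimod M) (Φ.dualOmega_eta M)

/-- The coaction on a kernel is determined by its image in the ambient comodule, since flatness of
`D` keeps the inclusion injective after `- ⊗ D`. In the ambient comodule the claim is
`eta_colinear`. -/
theorem unitHom_colinear (M : Comod D) (m : M.bimod) :
    kerCoaction hD (omegaColinear (Φ.pushOut.obj M) Φ.dualBicomod) (Φ.unitHom M m)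
      = mapLeft (Φ.unitHom M) D.bimod (M.ρ m) := by
  refine mapLeft_kerι_injective hD (omegaColinear (Φ.pushOut.obj M) Φ.dualBicomod) ?_
  refine (kerCoaction_spec hD _ _).trans ?_
  have hc : (kerι _).comp (Φ.unitHom M) = eta Φ.bimod M := rfl
  refine Eq.trans ?_ (mapLeft_comp (kerι (Φ.dualOmega (Φ.pushOut.obj M))) (Φ.unitHom M) _ _)
  rw [hc]
  refine Eq.trans (congrArg (assocInv _ _ _) (eta_colinear Φ.bimod M m).symm) ?_
  exact assocInv_assoc _ _ _ _

/-- The counit `(N □_C (Σ^* ⊗ D)) ⊗ Σ → N` of the adjunction. -/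
noncomputable def counitHom (N : Comod C) : Hom (ker (Φ.dualOmega N) ⊗ᵇ Φ.bimod) N.bimod :=
  (Φ.tensorEv N.bimod).comp (mapLeft (kerι (Φ.dualOmega N)) Φ.bimod)

/-- Special case of `coaction_tensorEv`, used twice: for the colinearity of the counit, and for its
injectivity when `σ` is bijective. -/
theorem coaction_counitHom (N : Comod C) (z : ker (Φ.dualOmega N) ⊗ᵇ Φ.bimod) :
    N.ρ (Φ.counitHom N z) = Φ.tensorσ N.bimod (mapLeft (kerι (Φ.dualOmega N)) Φ.bimod z) := by
  refine Φ.coaction_tensorEv N _ ?_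
  have h : (Φ.dualOmega N).comp (kerι (Φ.dualOmega N)) = Hom.zero _ _ :=
    hom_ext fun x => apply_kerι _ x
  rw [← mapLeft_comp, h, mapLeft_zero]

/-- `G N = N □_C (Σ^* ⊗ D)`. -/
noncomputable def pull (N : Comod C) : Comod D :=
  kerComod hD (omegaColinear N Φ.dualBicomod)

theorem pull_spec (N : Comod C) (u : ker (Φ.dualOmega N)) :
    mapLeft (kerι (Φ.dualOmega N)) D.bimod ((Φ.pull hD N).ρ u)
      = (RightComod.tensorLeft N.bimod (dualTensor D Φ.bimod)).ρ (kerι (Φ.dualOmega N) u) :=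
  kerCoaction_spec hD (omegaColinear N Φ.dualBicomod) u

/-- The other triangle identity, read inside `N ⊗ (Σ^* ⊗ D)`. The coaction of the kernel is a
restriction, so `η` may be computed in the ambient comodule, where `tensorEv_spread` applies. -/
theorem counitHom_spread (N : Comod C) (u : ker (Φ.dualOmega N)) :
    mapLeft (Φ.counitHom N) (Φ.bimod.dual ⊗ᵇ D.bimod) (eta Φ.bimod (Φ.pull hD N) u)
      = kerι (Φ.dualOmega N) u := by
  refine (mapLeft_comp _ _ _ _).trans
    (Eq.trans ?_ (Φ.tensorEv_spread N.bimod (kerι (Φ.dualOmega N) u)))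
  rw [← pull_spec Φ hD]
  exact congrArg _ (spread_naturality (kerι (Φ.dualOmega N)) Φ.bimod D.bimod
    ((Φ.pull hD N).ρ u)).symm

/-- On `u ⊗ x` both sides equal `N ⊗ σ` of the underlying element of `u` tensored with `x`. On the
right this is because the counit absorbs the spread-out coaction of `u`, by `counitHom_spread`. -/
theorem counitHom_colinear (N : Comod C) (z : ker (Φ.dualOmega N) ⊗ᵇ Φ.bimod) :
    N.ρ (Φ.counitHom N z) = mapLeft (Φ.counitHom N) C.bimod
      ((((Φ.pull hD N).tensorBase Φ.bimod).corestrict Φ.σ).ρ z) := by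
  rw [coaction_counitHom]
  have h : ∀ (v : ker (Φ.dualOmega N) ⊗ᵇ Φ.bimod ⊗ᵇ (Φ.bimod.dual ⊗ᵇ D.bimod)) (x : Φ.bimod),
      mapRight N.bimod Φ.σ.hom
        (assoc _ _ _ (mapLeft (Φ.counitHom N) (Φ.bimod.dual ⊗ᵇ D.bimod) v ⊠ x))
      = mapLeft (Φ.counitHom N) C.bimod
        (mapRight (ker (Φ.dualOmega N) ⊗ᵇ Φ.bimod) Φ.σ.hom (assoc _ _ _ (v ⊠ x))) :=
      fun v x => by
    induction v using tensor_ind with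
    | zero => simp
    | tmul _ _ => rfl
    | add v w hv hw => simp only [map_add, add_tmul, hv, hw]
  refine tensor_hom_congr
    (f := (Φ.tensorσ N.bimod).comp (mapLeft (kerι (Φ.dualOmega N)) Φ.bimod))
    (g := (mapLeft (Φ.counitHom N) C.bimod).comp
      (((Φ.pull hD N).tensorBase Φ.bimod).corestrict Φ.σ).ρ) (fun u x => ?_) z
  refine Eq.trans (b := mapRight N.bimod Φ.σ.hom (assoc _ _ _
    (mapLeft (Φ.counitHom N) (Φ.bimod.dual ⊗ᵇ D.bimod)
      (eta Φ.bimod (Φ.pull hD N) u) ⊠ x))) ?_ ?_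
  · rw [counitHom_spread]
    rfl
  · exact h _ x

/-- The unit of the adjunction, as a natural transformation. -/
noncomputable def unit : 𝟭 (Comod D) ⟶ Φ.pushOut ⋙ Φ.pullBack hD where
  app M :=
    { hom := Φ.unitHom M
      colinear := Φ.unitHom_colinear hD M }
  naturality _ M' f := RightComod.hom_ext fun m =>
    kerι_injective (Φ.dualOmega (Φ.pushOut.obj M')) (eta_naturality f Φ.bimod m)

/-- The counit of the adjunction, as a natural transformation. -/
noncomputable def counit : Φ.pullBack hD ⋙ Φ.pushOut ⟶ 𝟭 (Comod C) where
  app N :=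
    { hom := Φ.counitHom N
      colinear := Φ.counitHom_colinear hD N }
  naturality N N' f := RightComod.hom_ext fun z => by
    refine Eq.trans ?_ (Φ.tensorEv_naturality f.hom (mapLeft (kerι (Φ.dualOmega N)) Φ.bimod z))
    refine congrArg (Φ.tensorEv N'.bimod) ?_
    refine tensor_hom_congr (X := ker (Φ.dualOmega N))
      (f := (mapLeft (kerι (Φ.dualOmega N')) Φ.bimod).comp
        (mapLeft ((Φ.pullBack hD).map f).hom Φ.bimod))
      (g := (mapLeft (mapLeft f.hom (Φ.bimod.dual ⊗ᵇ D.bimod)) Φ.bimod).comp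
        (mapLeft (kerι (Φ.dualOmega N)) Φ.bimod)) (fun _ _ => rfl) z

/-- The push-out functor is left adjoint to the pull-back functor. -/
noncomputable def adjunction : Φ.pushOut ⊣ Φ.pullBack hD :=
  Adjunction.mkOfUnitCounit
    { unit := Φ.unit hD
      counit := Φ.counit hD
      left_triangle := by
        ext M z
        -- Unit followed by inclusion of the kernel is `η`, so the counit after the unit becomes
        -- `tensorEv` after `η ⊗ Σ`.
        refine Eq.trans (congrArg (Φ.tensorEv _) ?_) (Φ.tensorEv_eta M z)
        exact (mapLeft_comp (kerι (Φ.dualOmega (Φ.pushOut.obj M))) (Φ.unitHom M) Φ.bimod z).symm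
      right_triangle := by
        ext N u
        exact kerι_injective (Φ.dualOmega N) (Φ.counitHom_spread hD N u) }

end adjunction

end ModuleMorphism

namespace BiModule

/-! ## Bijective bimodule maps -/

/-- The inverse of a bijective bimodule map. -/
noncomputable def homInv {X Y : BiModule k R S} (f : Hom X Y) (hf : Function.Bijective f) :
    Hom Y X where
  toFun := (Equiv.ofBijective f hf).symm
  map_add' x y := hf.1 (by
    rw [map_add f]
    simp only [Equiv.ofBijective_apply_symm_apply])
  map_smul' r x := hf.1 (by
    rw [f.map_smul]
    simp only [Equiv.ofBijective_apply_symm_apply])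
  map_op_smul' s x := hf.1 (by
    rw [f.map_op_smul]
    simp only [Equiv.ofBijective_apply_symm_apply])

@[simp] theorem apply_homInv {X Y : BiModule k R S} (f : Hom X Y) (hf : Function.Bijective f)
    (y : Y) : f (homInv f hf y) = y := Equiv.ofBijective_apply_symm_apply f hf y

@[simp] theorem homInv_apply {X Y : BiModule k R S} (f : Hom X Y) (hf : Function.Bijective f)
    (x : X) : homInv f hf (f x) = x := Equiv.ofBijective_symm_apply_apply f hf x

theorem map_bijective {X X' : BiModule k R S} {Y Y' : BiModule k S T} (f : Hom X X')
    (g : Hom Y Y') (hf : Function.Bijective f) (hg : Function.Bijective g) :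
    Function.Bijective (map f g) :=
  Function.bijective_iff_has_inverse.2 ⟨map (homInv f hf) (homInv g hg),
    tensor_hom_congr (f := (map (homInv f hf) (homInv g hg)).comp (map f g)) (g := Hom.id _)
      (fun x y => by simp),
    tensor_hom_congr (f := (map f g).comp (map (homInv f hf) (homInv g hg))) (g := Hom.id _)
      (fun x y => by simp)⟩

theorem mapLeft_bijective {X X' : BiModule k R S} (f : Hom X X') (Y : BiModule k S T)
    (hf : Function.Bijective f) : Function.Bijective (mapLeft f Y) :=
  map_bijective f (Hom.id Y) hf Function.bijective_id

theorem mapRight_bijective (X : BiModule k R S) {Y Y' : BiModule k S T} (g : Hom Y Y')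
    (hg : Function.Bijective g) : Function.Bijective (mapRight X g) :=
  map_bijective (Hom.id X) g Function.bijective_id hg

theorem assoc_bijective (X : BiModule k R S) (Y : BiModule k S T) (Z : BiModule k T U) :
    Function.Bijective (assoc X Y Z) :=
  Function.bijective_iff_has_inverse.2 ⟨assocInv X Y Z, assocInv_assoc X Y Z, assoc_assocInv X Y Z⟩

/-! ## Flatness -/

theorem LeftFlat.of_bijective {X Y : BiModule k R S} (hX : LeftFlat X) (g : Hom X Y)
    (hg : Function.Bijective g) : LeftFlat Y := fun M N f hf => by
  have h : Function.Injective (mapLeft f Y ∘ mapRight M g) := by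
    have h : mapLeft f Y ∘ mapRight M g = mapRight N g ∘ mapLeft f X :=
      funext (mapLeft_mapRight f g)
    rw [h]
    exact (mapRight_bijective N g hg).1.comp (hX M N f hf)
  exact (Function.Injective.of_comp_iff' _ (mapRight_bijective M g hg)).1 h

/-- A left module with a finite dual basis is flat. -/
theorem leftFlat_dual (X : BiModule k R S) [RightFGP X] : LeftFlat X.dual := fun M N f hf => by
  -- `θ P i` evaluates the dual factor at the basis element `e i`. The expansion `z = ∑ θ i z ⊗ e*
  -- i` and the naturality of `θ` in `P` reduce injectivity of `f ⊗ X^*` to injectivity of `f` on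
  -- each coordinate.
  let θ (P : BiModule k k S) (i) : (P ⊗ᵇ X.dual : BiModule k k R) →+ P :=
    liftAdd (fun p (g : X.dual) => op (g (X.dualBasis.e i)) • p)
      (fun _ _ _ => smul_add _ _ _)
      (fun p g g' => add_smul (op (g _)) (op (g' _)) p)
      (fun p s g => (mul_smul (op (g _)) (op s) p).symm)
  have hθ : ∀ (P : BiModule k k S) (z : P ⊗ᵇ X.dual), ∑ i, θ P i z ⊠ X.dualBasis.f i = z :=
    fun P z => by
      induction z using tensor_ind with
      | zero => simp
      | tmul p g =>
        conv_rhs => rw [← X.dualBasis.sum_dual_eq g, tmul_sum]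
        exact Finset.sum_congr rfl fun i _ => tmul_balanced _ _ _
      | add v w hv hw => simp only [map_add, add_tmul, Finset.sum_add_distrib, hv, hw]
  have hf' : ∀ i z, θ N i (mapLeft f X.dual z) = f (θ M i z) := fun i z => by
    induction z using tensor_ind with
    | zero => simp
    | tmul p g => exact (f.map_op_smul _ _).symm
    | add v w hv hw => simp only [map_add, hv, hw]
  refine (injective_iff_map_eq_zero _).2 fun z hz => ?_
  rw [← hθ M z]
  refine Finset.sum_eq_zero fun i _ => ?_
  rw [hf (((hf' i z).symm.trans (congrArg _ hz)).trans ((map_zero _).trans (map_zero f).symm)),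
    zero_tmul]

/-- Restriction of the left scalars to the ground ring. -/
def restrict (X : BiModule k R S) : BiModule k k S :=
  letI : Module k X := Module.compHom X (algebraMap k R)
  { carrier := X
    smulComm := ⟨fun r s x => smul_comm (algebraMap k R r) s x⟩
    central := fun r x => X.central r x }

end BiModule

/-! ### Isomorphisms of corings and comodules. -/

section comodules

variable {C : Coring k A} {D : Coring k B}

theorem CoringHom.isIso_of_bijective {C C' : Coring k A} (φ : CoringHom C C')
    (h : Function.Bijective φ.hom) : φ.IsIso := by
  refine ⟨⟨homInv φ.hom h, fun c => ?_, fun c => ?_⟩, homInv_apply _ h, apply_homInv _ h⟩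
  -- The inverse respects the coproducts because this can be tested after the injective map `φ ⊗ φ`.
  · refine (map_bijective _ _ h h).1 ?_
    rw [← φ.comul, apply_homInv]
    exact (tensor_hom_congr (f := (map φ.hom φ.hom).comp (map (homInv φ.hom h) (homInv φ.hom h)))
      (g := Hom.id _) (fun x y => by simp) _).symm
  · rw [← φ.counit, apply_homInv]

theorem CoringHom.IsIso.bijective {C C' : Coring k A} {φ : CoringHom C C'} (h : φ.IsIso) :
    Function.Bijective φ.hom := by
  obtain ⟨ψ, h₁, h₂⟩ := h
  exact Function.bijective_iff_has_inverse.2 ⟨ψ.hom, h₁, h₂⟩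

theorem RightComod.isIso_of_bijective {M N : RightComod R D} (f : M ⟶ N)
    (h : Function.Bijective f.hom) : IsIso f :=
  ⟨{ hom := homInv f.hom h
     colinear := fun n => (mapLeft_bijective f.hom D.bimod h).1 (by
      have hc : f.hom.comp (homInv f.hom h) = Hom.id _ := BiModule.hom_ext (apply_homInv f.hom h)
      rw [← f.colinear, apply_homInv, ← mapLeft_comp, hc, mapLeft_id]) },
    RightComod.hom_ext (homInv_apply f.hom h), RightComod.hom_ext (apply_homInv f.hom h)⟩

theorem RightComod.bijective_of_isIso {M N : RightComod R D} (f : M ⟶ N) [IsIso f] :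
    Function.Bijective f.hom :=
  Function.bijective_iff_has_inverse.2 ⟨(inv f).hom,
    fun x => congrArg (fun t : M ⟶ M => t.hom x) (IsIso.hom_inv_id f),
    fun x => congrArg (fun t : N ⟶ N => t.hom x) (IsIso.inv_hom_id f)⟩

/-- An equivalence of categories preserves and reflects exactness. -/
theorem exact_map_iff_of_isEquivalence {𝒞 𝒟 : Type*} [Category* 𝒞] [Category* 𝒟]
    [Limits.HasZeroMorphisms 𝒞] [Limits.HasZeroMorphisms 𝒟] (F : 𝒞 ⥤ 𝒟) [F.IsEquivalence]
    [F.PreservesZeroMorphisms] (E : ShortComplex 𝒞) : E.Exact ↔ (E.map F).Exact := by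
  refine ⟨fun h => h.map F, fun h => ?_⟩
  -- For reflection, the inverse functor carries the exact image back to a complex isomorphic to
  -- `E`.
  have h' := h.map F.inv
  exact ShortComplex.exact_of_iso (E.mapNatIso F.asEquivalence.unitIso.symm) h'

/-! ## The cotensor product with `D ⊗ X` -/

/-- An element `w` of `C □_C Y` is the coaction of `(ε ⊗ Y) w`. -/
theorem coaction_lid_counit (Y : LeftComod C S) (w : C.bimod ⊗ᵇ Y.bimod)
    (hw : assoc _ _ _ (mapLeft C.Δ Y.bimod w) = mapRight C.bimod Y.lam w) :
    Y.lam (lid _ (mapLeft C.ε Y.bimod w)) = w := by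
  -- Mirror image of `coaction_rid_counit`: `ε ⊗ (C ⊗ Y)` is applied to both sides of `hw`; left
  -- linearity of the coaction handles one side and the left counit law the other.
  let P := (lid (C.bimod ⊗ᵇ Y.bimod)).comp (mapLeft C.ε (C.bimod ⊗ᵇ Y.bimod))
  have h₁ : P (mapRight C.bimod Y.lam w) = Y.lam (lid _ (mapLeft C.ε Y.bimod w)) :=
    tensor_hom_congr (f := P.comp (mapRight C.bimod Y.lam))
      (g := Y.lam.comp ((lid _).comp (mapLeft C.ε Y.bimod)))
      (fun c y => (Y.lam.map_smul (show A from C.ε c) y).symm) w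
  have h₂ : P (assoc _ _ _ (mapLeft C.Δ Y.bimod w)) = w := by
    refine tensor_hom_congr (f := P.comp ((assoc _ _ _).comp (mapLeft C.Δ Y.bimod)))
      (g := Hom.id _) (fun c y => ?_) w
    have h : ∀ v : C.bimod ⊗ᵇ C.bimod, P (assoc _ _ _ (v ⊠ y))
        = lid _ (mapLeft C.ε C.bimod v) ⊠ y := fun v => by
      induction v using tensor_ind with
      | zero => simp
      | tmul n c => rfl
      | add v w hv hw => simp only [map_add, add_tmul, hv, hw]
    exact (h _).trans (by rw [C.counit_left]; rfl)
  rw [← h₁, ← hw, h₂]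

/-- The map `M ⊗ (D ⊗ X) → M ⊗ X` given by the counit. -/
def tensorCounit (D : Coring k B) (M : BiModule k R B) (X : BiModule k B S) :
    Hom (M ⊗ᵇ (D.bimod ⊗ᵇ X)) (M ⊗ᵇ X) :=
  mapRight M ((lid X).comp (mapLeft D.ε X))

/-- The coaction `M ⊗ X → M ⊗ (D ⊗ X)`. -/
def tensorCoaction (M : RightComod R D) (X : BiModule k B S) :
    Hom (M.bimod ⊗ᵇ X) (M.bimod ⊗ᵇ (D.bimod ⊗ᵇ X)) :=
  (assoc _ _ _).comp (mapLeft M.ρ X)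

/-- The counit law of `M`, tensored with `X`. -/
theorem tensorCounit_tensorCoaction (M : RightComod R D) (X : BiModule k B S)
    (z : M.bimod ⊗ᵇ X) : tensorCounit D M.bimod X (tensorCoaction M X z) = z := by
  refine tensor_hom_congr (f := (tensorCounit D M.bimod X).comp (tensorCoaction M X))
    (g := Hom.id _) (fun m x => ?_) z
  have h : ∀ v : M.bimod ⊗ᵇ D.bimod, tensorCounit D M.bimod X (assoc _ _ _ (v ⊠ x))
      = rid _ (mapRight M.bimod D.ε v) ⊠ x := fun v => by
    induction v using tensor_ind with
    | zero => simp
    | tmul m d => exact (tmul_balanced m (show B from D.ε d) x).symm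
    | add v w hv hw => simp only [map_add, add_tmul, hv, hw]
  exact (h _).trans (by rw [M.counit]; rfl)

/-- Coassociativity of `M`, tensored with `X`: the coaction of `M ⊗ X` lands in the cotensor
product. -/
theorem omega_tensorCoaction (M : RightComod R D) (X : BiModule k B S) (z : M.bimod ⊗ᵇ X) :
    omega M (LeftComod.free D X) (tensorCoaction M X z) = 0 := by
  refine tensor_hom_congr (f := (omega M (LeftComod.free D X)).comp (tensorCoaction M X))
    (g := Hom.zero _ _) (fun m x => ?_) z
  have h₁ : ∀ v : M.bimod ⊗ᵇ D.bimod,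
      assoc _ _ _ (mapLeft M.ρ (D.bimod ⊗ᵇ X) (assoc _ _ _ (v ⊠ x)))
      = mapRight M.bimod (assoc _ _ _)
        (assoc _ _ _ (assoc _ _ _ (mapLeft M.ρ D.bimod v) ⊠ x)) := fun v => by
    induction v using tensor_ind with
    | zero => simp
    | tmul m d =>
      simp only [assoc_tmul, mapLeft_tmul]
      generalize M.ρ m = v
      induction v using tensor_ind with
      | zero => simp
      | tmul m d => rfl
      | add v w hv hw => simp only [map_add, add_tmul, hv, hw]
    | add v w hv hw => simp only [map_add, add_tmul, hv, hw]
  have h₂ : ∀ v : M.bimod ⊗ᵇ D.bimod,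
      mapRight M.bimod ((assoc _ _ _).comp (mapLeft D.Δ X)) (assoc _ _ _ (v ⊠ x))
      = mapRight M.bimod (assoc _ _ _)
        (assoc _ _ _ (mapRight M.bimod D.Δ v ⊠ x)) := fun v => by
    induction v using tensor_ind with
    | zero => simp
    | tmul m d => rfl
    | add v w hv hw => simp only [map_add, add_tmul, hv, hw]
  refine sub_eq_zero.2 ((h₁ (M.ρ m)).trans (Eq.trans ?_ (h₂ (M.ρ m)).symm))
  rw [M.coassoc]

/-- Apply `M ⊗ D ⊗ (ε ⊗ X)` to the two terms of `ω w = 0`. The term with `Δ` returns `w`, by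
`tensorCounit_tensorCoaction` for `D` over itself; the term with `ρ` is the left-hand side. -/
theorem tensorCoaction_tensorCounit (M : RightComod R D) (X : BiModule k B S)
    (w : M.bimod ⊗ᵇ (D.bimod ⊗ᵇ X)) (hw : omega M (LeftComod.free D X) w = 0) :
    tensorCoaction M X (tensorCounit D M.bimod X w) = w := by
  let P := mapRight M.bimod (tensorCounit D D.bimod X)
  have h₁ : P (mapRight M.bimod ((assoc _ _ _).comp (mapLeft D.Δ X)) w) = w :=
    tensor_hom_congr (f := P.comp (mapRight M.bimod ((assoc _ _ _).comp (mapLeft D.Δ X))))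
      (g := Hom.id _)
      (fun m y => congrArg (fun y => m ⊠ y)
        (tensorCounit_tensorCoaction (RightComod.self D) X y)) w
  have h₂ : P (assoc _ _ _ (mapLeft M.ρ (D.bimod ⊗ᵇ X) w))
      = tensorCoaction M X (tensorCounit D M.bimod X w) := by
    refine tensor_hom_congr (f := P.comp ((assoc _ _ _).comp (mapLeft M.ρ (D.bimod ⊗ᵇ X))))
      (g := (tensorCoaction M X).comp (tensorCounit D M.bimod X)) (fun m y => ?_) w
    change P (assoc _ _ _ (M.ρ m ⊠ y))
      = assoc _ _ _ (M.ρ m ⊠ lid X (mapLeft D.ε X y))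
    generalize M.ρ m = v
    induction v using tensor_ind with
    | zero => simp
    | tmul m d => rfl
    | add v w hv hw => simp only [map_add, add_tmul, hv, hw]
  exact h₂.symm.trans ((congrArg P (sub_eq_zero.1 hw)).trans h₁)

/-- The isomorphism `M □_D (D ⊗ X) → M ⊗ X`. -/
def cotensorFree (M : RightComod R D) (X : BiModule k B S) :
    Hom (cotensor M (LeftComod.free D X)) (M.bimod ⊗ᵇ X) :=
  (tensorCounit D M.bimod X).comp (kerι (omega M (LeftComod.free D X)))

theorem cotensorFree_bijective (M : RightComod R D) (X : BiModule k B S) :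
    Function.Bijective (cotensorFree M X) :=
  Function.bijective_iff_has_inverse.2
    ⟨kerLift (omega M (LeftComod.free D X)) (tensorCoaction M X) (omega_tensorCoaction M X),
      fun x => kerι_injective (omega M (LeftComod.free D X))
        (tensorCoaction_tensorCounit M X _ (apply_kerι _ x)),
      tensorCounit_tensorCoaction M X⟩

theorem cotensorFree_naturality {M N : RightComod R D} (f : M ⟶ N) (X : BiModule k B S)
    (x : cotensor M (LeftComod.free D X)) :
    cotensorFree N X (cotensorMap f (LeftComod.free D X) x)
      = mapLeft f.hom X (cotensorFree M X x) :=
  (mapLeft_mapRight f.hom _ _).symm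

/-- Exactness is transported along the natural bijections `M □_D (D ⊗ X) → M ⊗ X`. -/
theorem cotensorFunctor_free_exact_iff (X : BiModule k B S) (E : ShortComplex (Comod D)) :
    (E.map (cotensorFunctor (LeftComod.free D X))).Exact ↔
      ∀ x, mapLeft E.g.hom X x = 0 → ∃ y, mapLeft E.f.hom X y = x := by
  refine (ShortComplex.moduleCat_exact_iff _).trans ⟨fun h x hx => ?_, fun h x hx => ?_⟩
  · obtain ⟨x, rfl⟩ := (cotensorFree_bijective E.X₂ X).2 x
    rw [← cotensorFree_naturality] at hx
    obtain ⟨y, hy⟩ := h x ((cotensorFree_bijective E.X₃ X).1 (hx.trans (map_zero _).symm))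
    exact ⟨cotensorFree E.X₁ X y, (cotensorFree_naturality E.f X y).symm.trans
      (congrArg (cotensorFree E.X₂ X) hy)⟩
  · obtain ⟨y, hy⟩ := h (cotensorFree E.X₂ X x) ((cotensorFree_naturality E.g X x).symm.trans
      ((congrArg (cotensorFree E.X₃ X) hx).trans (map_zero _)))
    obtain ⟨y, rfl⟩ := (cotensorFree_bijective E.X₁ X).2 y
    exact ⟨y, (cotensorFree_bijective E.X₂ X).1 ((cotensorFree_naturality E.f X y).trans hy)⟩

/-- A comodule with left scalars restricted to the ground ring. -/
def RightComod.restrict (M : RightComod R D) : Comod D where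
  bimod := M.bimod.restrict
  ρ :=
    { toFun := M.ρ
      map_add' := map_add M.ρ
      map_smul' := fun r x => M.ρ.map_smul (algebraMap k R r) x
      map_op_smul' := fun s x => M.ρ.map_op_smul s x }
  coassoc := M.coassoc
  counit := M.counit

end comodules

namespace ModuleMorphism

variable {C : Coring k A} {D : Coring k B} (Φ : ModuleMorphism D C)

/-! ## From a faithfully coflat `D ⊗ Σ` to an equivalence -/

/-- `- ⊗_B X` preserves and reflects exactness of sequences of right `D`-comodules. -/
def TensorExact (D : Coring k B) (X : BiModule k B S) : Prop :=
  ∀ E : ShortComplex (Comod D), E.Exact ↔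
    ∀ x, mapLeft E.g.hom X x = 0 → ∃ y, mapLeft E.f.hom X y = x

theorem faithfullyCoflat_iff : FaithfullyCoflat Φ.leftComod ↔ TensorExact D Φ.bimod :=
  forall_congr' fun E => iff_congr Iff.rfl (cotensorFunctor_free_exact_iff Φ.bimod E)

/-- Injectivity is exactness of `M → M → N` whose first arrow is zero. Taking the zero endomorphism
of `M` as that arrow avoids a separate zero object. -/
theorem TensorExact.injective_iff (hD : LeftFlat D.bimod) {X : BiModule k B S}
    (h : TensorExact D X) {M N : Comod D} (f : M ⟶ N) :
    Function.Injective f.hom ↔ Function.Injective (mapLeft f.hom X) := by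
  have h' := (comod_exact_iff hD (ShortComplex.mk (0 : M ⟶ M) f Limits.zero_comp)).symm.trans
    (h (ShortComplex.mk (0 : M ⟶ M) f Limits.zero_comp))
  rw [injective_iff_map_eq_zero, injective_iff_map_eq_zero]
  refine (Iff.trans ?_ h').trans ?_
  · exact forall₂_congr fun x _ => ⟨fun hx => ⟨0, hx.symm⟩, fun ⟨_, hy⟩ => hy.symm⟩
  · exact forall₂_congr fun x _ => ⟨fun ⟨y, hy⟩ => hy.symm.trans (mapLeft_zero X y),
      fun hx => ⟨0, (map_zero _).trans hx.symm⟩⟩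

/-- Dually, surjectivity is exactness of `M → N → N` with second arrow zero. -/
theorem TensorExact.surjective_iff (hD : LeftFlat D.bimod) {X : BiModule k B S}
    (h : TensorExact D X) {M N : Comod D} (f : M ⟶ N) :
    Function.Surjective f.hom ↔ Function.Surjective (mapLeft f.hom X) := by
  have h' := (comod_exact_iff hD (ShortComplex.mk f (0 : N ⟶ N) Limits.comp_zero)).symm.trans
    (h (ShortComplex.mk f (0 : N ⟶ N) Limits.comp_zero))
  refine (Iff.trans ?_ h').trans ?_
  · exact forall_congr' fun x => ⟨fun hx _ => hx, fun hx => hx rfl⟩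
  · exact forall_congr' fun x => ⟨fun hx => hx (mapLeft_zero X x), fun hx _ => hx⟩

/-- If `σ` is an isomorphism and `D ⊗ Σ` is coflat, then `C` is flat. -/
theorem leftFlat_of_tensorExact (hD : LeftFlat D.bimod) (hσ : Function.Bijective Φ.σ.hom)
    (h : TensorExact D Φ.bimod) : LeftFlat C.bimod := by
  -- It suffices to treat `Σ[D]`. An injective `f` is tensored with `Σ^*`, which has a dual basis,
  -- then with `D`, which is flat, then with `Σ`.
  refine LeftFlat.of_bijective (X := baseExtBimod D Φ.bimod) (fun M N f hf => ?_) Φ.σ.hom hσ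
  have h₁ : Function.Injective (mapLeft (mapLeft f Φ.bimod.dual) D.bimod) :=
    hD _ _ _ (leftFlat_dual Φ.bimod M N f hf)
  have h₂ : Function.Injective (mapLeft f (Φ.bimod.dual ⊗ᵇ D.bimod)) := by
    refine (Function.Injective.of_comp_iff' _ (assoc_bijective M Φ.bimod.dual D.bimod)).1 ?_
    rw [show mapLeft f _ ∘ assoc M Φ.bimod.dual D.bimod
      = assoc N Φ.bimod.dual D.bimod ∘ mapLeft (mapLeft f _) _ from
        funext (mapLeft_assoc f _ _)]
    exact (assoc_bijective _ _ _).1.comp h₁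
  -- `Σ` itself need not be flat over `B`: this step works because `f ⊗ (Σ^* ⊗ D)` is a colinear map
  -- of `D`-comodules, for which coflatness suffices.
  have h₃ : Function.Injective (mapLeft (mapLeft f (Φ.bimod.dual ⊗ᵇ D.bimod)) Φ.bimod) :=
    (h.injective_iff hD (M := RightComod.tensorLeft M (dualTensor D Φ.bimod))
      (N := RightComod.tensorLeft N (dualTensor D Φ.bimod))
      (mapLeftColinear f (dualTensor D Φ.bimod))).1 h₂
  refine (Function.Injective.of_comp_iff' _
    (assoc_bijective M (Φ.bimod.dual ⊗ᵇ D.bimod) Φ.bimod)).1 ?_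
  rw [show mapLeft f _ ∘ assoc M (Φ.bimod.dual ⊗ᵇ D.bimod) Φ.bimod
    = assoc N (Φ.bimod.dual ⊗ᵇ D.bimod) Φ.bimod ∘ mapLeft (mapLeft f _) _ from
      funext (mapLeft_assoc f _ _)]
  exact (assoc_bijective _ _ _).1.comp h₃

theorem tensorσ_bijective (hσ : Function.Bijective Φ.σ.hom) (N : BiModule k R A) :
    Function.Bijective (Φ.tensorσ N) :=
  (mapRight_bijective N Φ.σ.hom hσ).comp (assoc_bijective _ _ _)

/-- If `σ` is an isomorphism and `D ⊗ Σ` is coflat, the counit of the adjunction is bijective. -/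
theorem counitHom_bijective (hD : LeftFlat D.bimod) (hσ : Function.Bijective Φ.σ.hom)
    (h : TensorExact D Φ.bimod) (N : Comod C) : Function.Bijective (Φ.counitHom N) := by
  constructor
  · refine (injective_iff_map_eq_zero _).2 fun z hz => ?_
    -- If the counit kills `z`, so does `N ⊗ σ`. As `σ` is bijective, `z` vanishes in `N ⊗ (Σ^* ⊗ D)
    -- ⊗ Σ`, and coflatness keeps the inclusion of the kernel injective after `- ⊗ Σ`.
    have h₁ := Φ.coaction_counitHom N z
    rw [hz, map_zero] at h₁
    have h₂ := (Φ.tensorσ_bijective hσ N.bimod).1 (h₁.symm.trans (map_zero _).symm)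
    have h₃ : Function.Injective (mapLeft (kerι (Φ.dualOmega N)) Φ.bimod) :=
      (h.injective_iff hD (kerComodι hD (omegaColinear N Φ.dualBicomod))).1
        (kerι_injective (Φ.dualOmega N))
    exact h₃ (h₂.trans (map_zero _).symm)
  · intro n
    -- The candidate preimage of `n` is the element that `N ⊗ σ` sends to `ρ n`. Coassociativity of
    -- `ρ` puts it in the kernel of `ω ⊗ Σ`.
    obtain ⟨w, hw⟩ := (Φ.tensorσ_bijective hσ N.bimod).2 (N.ρ n)
    have h₁ : mapLeft (Φ.dualOmega N) Φ.bimod w = 0 := by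
      refine (assoc_bijective _ _ _).1
        ((mapRight_bijective N.bimod _ (Φ.tensorσ_bijective hσ C.bimod)).1 ?_)
      rw [map_zero, map_zero, tensorσ_dualOmega, hw, sub_eq_zero, N.coassoc]
    -- The sequence `ker ω → · → ·` is exact, hence stays exact after `- ⊗ Σ`. So `w`, killed by `ω
    -- ⊗ Σ`, comes from `ker ω ⊗ Σ`, the source of the counit.
    let E : ShortComplex (Comod D) := ShortComplex.mk
      (kerComodι hD (omegaColinear N Φ.dualBicomod)) (omegaColinear N Φ.dualBicomod)
      (kerComodι_comp hD (omegaColinear N Φ.dualBicomod))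
    have hE : E.Exact := (comod_exact_iff hD E).2 fun x hx => ⟨kerMk (Φ.dualOmega N) x hx, rfl⟩
    obtain ⟨z, hz⟩ := (h E).1 hE w h₁
    refine ⟨z, Eq.trans (b := Φ.tensorEv N.bimod w) (congrArg (Φ.tensorEv N.bimod) hz) ?_⟩
    exact (congrArg (fun v => rid _ (mapRight N.bimod C.ε v)) hw).trans (N.counit n)

/-- If `σ` is an isomorphism and `D ⊗ Σ` is faithfully coflat, the unit of the adjunction is
bijective. -/
theorem unitHom_bijective (hD : LeftFlat D.bimod) (hσ : Function.Bijective Φ.σ.hom)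
    (h : TensorExact D Φ.bimod) (M : Comod D) : Function.Bijective (Φ.unitHom M) := by
  -- By a triangle identity, the unit tensored with `Σ` is a right inverse of a counit already known
  -- to be bijective; it is therefore bijective, and `- ⊗ Σ` reflects this back to the unit.
  have h₁ : Φ.counitHom (Φ.pushOut.obj M) ∘ mapLeft (Φ.unitHom M) Φ.bimod = id :=
    funext fun z => congrArg (fun t : Φ.pushOut.obj M ⟶ _ => t.hom z)
      ((Φ.adjunction hD).left_triangle_components M)
  have h₂ : Function.Bijective (mapLeft (Φ.unitHom M) Φ.bimod) := by
    refine (Function.Bijective.of_comp_iff' (Φ.counitHom_bijective hD hσ h _) _).1 ?_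
    rw [h₁]
    exact Function.bijective_id
  exact ⟨(h.injective_iff hD ((Φ.unit hD).app M)).2 h₂.1,
    (h.surjective_iff hD ((Φ.unit hD).app M)).2 h₂.2⟩

/-! ## From an equivalence to a faithfully coflat `D ⊗ Σ` -/

/-- The right `C`-comodule `C`. -/
abbrev selfComod (C : Coring k A) : Comod C := (RightComod.self C).restrict

/-- The coaction of `Σ^* ⊗ D` as a map to `C □_C (Σ^* ⊗ D)`. -/
noncomputable def lamSelf : Hom (Φ.bimod.dual ⊗ᵇ D.bimod).restrict
    (ker (Φ.dualOmega (selfComod C))) :=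
  kerLift (Φ.dualOmega (selfComod C))
    { toFun := Φ.dualLam
      map_add' := map_add Φ.dualLam
      map_smul' := fun r x => Φ.dualLam.map_smul (algebraMap k A r) x
      map_op_smul' := fun s x => Φ.dualLam.map_op_smul s x }
    fun y => sub_eq_zero.2 (Φ.dualBicomod.coassoc y)

/-- The isomorphism `Y ≅ C □_C Y` for `Y = Σ^* ⊗ D`: injectivity is the left counit law,
surjectivity is `coaction_lid_counit`. -/
theorem lamSelf_bijective : Function.Bijective Φ.lamSelf := by
  constructor
  · intro y y' h
    have h' : Φ.dualLam y = Φ.dualLam y' := congrArg (kerι (Φ.dualOmega (selfComod C))) h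
    exact (Φ.dualBicomod.counit y).symm.trans ((congrArg (fun v => lid _
      (mapLeft C.ε (Φ.bimod.dual ⊗ᵇ D.bimod) v)) h').trans (Φ.dualBicomod.counit y'))
  · intro w
    exact ⟨_, kerι_injective (Φ.dualOmega (selfComod C))
      (coaction_lid_counit Φ.dualBicomod.toLeftComod _ (sub_eq_zero.1 (apply_kerι _ w)))⟩

/-- By `comul_σ`, the counit of the adjunction at `C` becomes `(C ⊗ ε) ∘ Δ ∘ σ`, which is `σ` by the
right counit law. An invertible counit at this one comodule thus determines that `σ` is bijective.
-/
theorem counitHom_lamSelf (z : (Φ.bimod.dual ⊗ᵇ D.bimod).restrict ⊗ᵇ Φ.bimod) :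
    Φ.counitHom (selfComod C) (mapLeft Φ.lamSelf Φ.bimod z)
      = Φ.σ.hom (show baseExtBimod D Φ.bimod from z) := by
  induction z using tensor_ind with
  | zero => exact (map_zero (Φ.counitHom (selfComod C))).trans (map_zero Φ.σ.hom).symm
  | tmul y x =>
    refine Eq.trans (b := rid _ (mapRight C.bimod C.ε
      (Φ.tensorσ C.bimod (Φ.dualLam y ⊠ x)))) rfl ?_
    exact (congrArg (fun v => rid _ (mapRight C.bimod C.ε v)) (Φ.comul_σ y x).symm).trans
      (C.counit_right _)
  | add v w hv hw =>
    exact (map_add ((Φ.counitHom (selfComod C)).comp (mapLeft Φ.lamSelf Φ.bimod)) v w).trans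
      ((congrArg₂ (· + ·) hv hw).trans (map_add Φ.σ.hom _ _).symm)

theorem σ_bijective (h : Function.Bijective (Φ.counitHom (selfComod C))) :
    Function.Bijective Φ.σ.hom := by
  have h' := h.comp (mapLeft_bijective Φ.lamSelf Φ.bimod Φ.lamSelf_bijective)
  rw [show Φ.counitHom (selfComod C) ∘ mapLeft Φ.lamSelf Φ.bimod = Φ.σ.hom from
    funext Φ.counitHom_lamSelf] at h'
  exact h'

end ModuleMorphism

end BimCoring

theorem theorem5p2 {k : Type u} [CommRing k] {A : Type u} [Ring A] [Algebra k A]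
    {B : Type u} [Ring B] [Algebra k B] (D : BimCoring.Coring k B) (C : BimCoring.Coring k A)
    (Φ : BimCoring.ModuleMorphism D C) (hD : D.bimod.LeftFlat) :
    (Φ.σ.IsIso ∧ BimCoring.FaithfullyCoflat Φ.leftComod) ↔
      (C.bimod.LeftFlat ∧
        ∃ e : BimCoring.Comod C ≌ BimCoring.Comod D,
          e.functor = Φ.pullBack hD ∧ e.inverse = Φ.pushOut) := by
  constructor
  · rintro ⟨hσ, hX⟩
    have hσ' := hσ.bijective
    have h := Φ.faithfullyCoflat_iff.1 hX
    have (M : BimCoring.Comod D) : IsIso ((Φ.adjunction hD).unit.app M) :=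
      BimCoring.RightComod.isIso_of_bijective _ (Φ.unitHom_bijective hD hσ' h M)
    have (N : BimCoring.Comod C) : IsIso ((Φ.adjunction hD).counit.app N) :=
      BimCoring.RightComod.isIso_of_bijective _ (Φ.counitHom_bijective hD hσ' h N)
    -- The adjunction has push-out as left adjoint, so its equivalence starts at `D`-comodules and
    -- is reversed to match the stated direction.
    exact ⟨Φ.leftFlat_of_tensorExact hD hσ' h, (Φ.adjunction hD).toEquivalence.symm, rfl, rfl⟩
  · rintro ⟨hC, e, -, he⟩
    -- The unit and counit of `e` need not be those of `adjunction`, but a left adjoint that is an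
    -- equivalence makes the counit of any of its adjunctions invertible.
    have : Φ.pushOut.IsEquivalence := he ▸ e.isEquivalence_inverse
    refine ⟨Φ.σ.isIso_of_bijective (Φ.σ_bijective ?_), Φ.faithfullyCoflat_iff.2 fun E => ?_⟩
    · exact BimCoring.RightComod.bijective_of_isIso
        ((Φ.adjunction hD).counit.app (BimCoring.ModuleMorphism.selfComod C))
    -- Flatness of `C` is what identifies exactness of `Σ_∘ E` in `M^C` with exactness of the groups
    -- `E ⊗_B Σ`, that is, with the condition in `TensorExact`.
    · exact (BimCoring.exact_map_iff_of_isEquivalence Φ.pushOut E).trans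
        (BimCoring.comod_exact_iff hC (E.map Φ.pushOut))
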